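/- Let $G=(V,E)$ be a 1PI (two-edge connected) Feynman diagram: a finite multigraph (parallel edges and self-loops allowed) that is connected and stays connected when any one edge is removed, with a mass $m_e\in\mathbb{R}$ on each edge and momenta $p_v$ on a set $V_{\rm ext}\subseteq V$ of external vertices satisfying $\sum_{v\in V_{\rm ext}}p_v=0$. Momenta lie in a real vector space with a quadratic form $|\cdot|^2$ (minus the Lorentz square, $|q|^2=-q^2$). For a spanning two-forest $F=(T,T')$ put $p(F)=\sum_{v\in T\cap V_{\rm ext}}p_v$. Assume that $|\cdot|^2$ is positive definite (Wick-rotated momenta), or that $|p(F)|^2>0$ for every spanning two-forest $F$ (Euclidean region). Define $$\mathcal U=\sum_{T\text{ spanning tree}}\ \prod_{e\notin T}x_e,\qquad \mathcal F_0=\sum_{F\text{ spanning two-forest}}|p(F)|^2\prod_{e\notin F}x_e,\qquad \mathcal F=\mathcal U\sum_{e\in E}m_e^2x_e+\mathcal F_0 ,$$ and let $P_G=\mathrm{Newt}(\mathcal U+\mathcal F)$, $P_U=\mathrm{Newt}(\mathcal U)$, $P_{F_0}=\mathrm{Newt}(\mathcal F_0)$ be the Newton polytopes (convex hulls of the exponent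 vectors of the occurring monomials). A lattice polytope $P\subset\mathbb{R}^d$ is called normal, or IDP, if $kP\cap\mathbb{Z}^d=\big((k-1)P\cap\mathbb{Z}^d\big)+\big(P\cap\mathbb{Z}^d\big)$ for every integer $k\ge 1$. It is edge-unimodular if there is an integer matrix $M$ with $d$ rows, of rank $d$ and with all $d\times d$ minors in $\{0,1,-1\}$, such that every edge of $P$ is parallel to a column of $M$. The Cayley sum $P*Q\subset\mathbb{R}^{d+1}$ is the convex hull of $(P\times\{0\})\cup(Q\times\{1\})$. 1. If $m_e\ne0$ for all $e\in E$, then $P_G=P_U+\mathrm{conv}(0,e_1,\dots,e_{|E|})$ (Minkowski sum), and $P_G$ is edge-unimodular and IDP. 2. If $m_e=0$ for all $e\in E$, $V_{\rm ext}=V$ and $|p_v|^2\neq0$ for every $v\in V$, then $P_G$ is the Cayley sum $P_U*P_{F_0}$, in the sense that the injective affine map $y\mapsto\big(y,\ \sum_e y_e-L\big)$, $L=|E|-|V|+1$, maps $P_G\subset\mathbb{R}^{|E|}$ onto $P_U*P_{F_0}\subset\mathbb{R}^{|E|+1}$; and both $P_U*P_{F_0}$ and $P_G$ are IDP. -/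

import Mathlib

open scoped Pointwise

/-! ### Lattice polytopes -/

/-- The lattice `ℤ^ι` inside `ℝ^ι`. -/
def latticePoints (ι : Type*) : Set (ι → ℝ) :=
  Set.range fun (z : ι → ℤ) (i : ι) => (z i : ℝ)

/-- A polytope `P ⊆ ℝ^ι` is normal, i.e. has the integer decomposition property (IDP), if
`kP ∩ ℤ^ι = ((k - 1)P ∩ ℤ^ι) + (P ∩ ℤ^ι)` for every positive integer `k`. -/
def IsIDP {ι : Type*} (P : Set (ι → ℝ)) : Prop :=
  ∀ k : ℕ, 1 ≤ k →
    ((k : ℝ) • P) ∩ latticePoints ι =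
      ((((k : ℝ) - 1) • P) ∩ latticePoints ι) + (P ∩ latticePoints ι)

open scoped Classical in
/-- An integer matrix with `d` rows is unimodular if it has rank `d` and all its `d × d` minors
are `0`, `1` or `-1`. -/
def IsUnimodularMatrix {ι κ : Type*} [Fintype ι] [Fintype κ] (M : Matrix ι κ ℤ) : Prop :=
  (M.map (fun z : ℤ => (z : ℚ))).rank = Fintype.card ι ∧
    ∀ c : ι → κ, (M.submatrix id c).det = 0 ∨ (M.submatrix id c).det = 1 ∨
      (M.submatrix id c).det = -1

/-- The segment `[x, y]` is an edge (a one-dimensional face) of `P`. -/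
def IsEdgeOf {ι : Type*} (P : Set (ι → ℝ)) (x y : ι → ℝ) : Prop :=
  x ≠ y ∧ IsExposed ℝ P (segment ℝ x y)

/-- `P` is edge-unimodular: every edge of `P` is parallel to a column of one unimodular matrix. -/
def IsEdgeUnimodular {ι : Type*} [Fintype ι] (P : Set (ι → ℝ)) : Prop :=
  ∃ (n : ℕ) (M : Matrix ι (Fin n) ℤ), IsUnimodularMatrix M ∧
    ∀ x y : ι → ℝ, IsEdgeOf P x y →
      ∃ (j : Fin n) (t : ℝ), y - x = t • (fun i => (M i j : ℝ))

/-- The point `(y, t)` of `ℝ^ι × ℝ = ℝ^(Option ι)`; the additional coordinate is `none`. -/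
def appendCoord {ι : Type*} (y : ι → ℝ) (t : ℝ) : Option ι → ℝ :=
  fun o => o.elim t y

/-- The Cayley sum of `P` and `Q`: the convex hull of `(P × {0}) ∪ (Q × {1})`. -/
def cayleySum {ι : Type*} (P Q : Set (ι → ℝ)) : Set (Option ι → ℝ) :=
  convexHull ℝ (((fun y => appendCoord y 0) '' P) ∪ ((fun y => appendCoord y 1) '' Q))

open scoped Classical in
/-- The simplex with vertices `0` and all the standard basis vectors of `ℝ^ι`. -/
def cornerSimplex (ι : Type*) : Set (ι → ℝ) :=
  convexHull ℝ (insert 0 (Set.range fun i : ι => (Pi.single i (1 : ℝ) : ι → ℝ)))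

/-- The Newton polytope: the convex hull of the exponent vectors of the monomials that occur. -/
def newtonPolytope {ι : Type*} (f : MvPolynomial ι ℝ) : Set (ι → ℝ) :=
  convexHull ℝ ((fun (a : ι →₀ ℕ) (i : ι) => (a i : ℝ)) '' (f.support : Set (ι →₀ ℕ)))

/-! ### Feynman diagrams -/

/-- A scalar Feynman diagram: a finite multigraph (parallel edges and self-loops are allowed) with
a mass at every edge and a set of external vertices carrying momenta which sum to zero. Momenta
live in a real vector space `W` with a quadratic form `form`, where `form q` is the coefficient
`|q|²` (equal to `-q²` if the Wick rotation is undone). -/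
structure FeynmanDiagram (V E W : Type*) [AddCommGroup W] [Module ℝ W] where
  ends : E → Sym2 V
  mass : E → ℝ
  ext : Finset V
  mom : V → W
  form : QuadraticForm ℝ W
  conservation : ∑ v ∈ ext, mom v = 0

namespace FeynmanDiagram

variable {V E W : Type*} [AddCommGroup W] [Module ℝ W]

/-- The adjacency graph on all of `V` of the spanning subgraph with edge set `S`. It has the same
connected components as that subgraph. -/
def sub (G : FeynmanDiagram V E W) (S : Set E) : SimpleGraph V where
  Adj u v := u ≠ v ∧ ∃ e ∈ S, G.ends e = s(u, v)
  symm := ⟨fun u v ⟨h, e, he, h'⟩ => ⟨h.symm, e, he, by rw [h', Sym2.eq_swap]⟩⟩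
  loopless := ⟨fun _ h => h.1 rfl⟩

/-- `G` is one particle irreducible (two-edge connected): it is connected, and remains connected
whenever one edge is removed. -/
def IsOnePI (G : FeynmanDiagram V E W) : Prop :=
  (G.sub Set.univ).Connected ∧ ∀ e : E, (G.sub {e}ᶜ).Connected

/-- The edge set `S` contains no cycle (no self-loop, no pair of parallel edges, and no longer
cycle): removing any edge of `S` disconnects its end points. -/
def IsForest (G : FeynmanDiagram V E W) (S : Set E) : Prop :=
  ∀ e ∈ S, ∀ u v : V, G.ends e = s(u, v) → ¬ (G.sub (S \ {e})).Reachable u v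

/-- `S` is the edge set of a spanning tree. -/
def IsSpanningTree (G : FeynmanDiagram V E W) (S : Set E) : Prop :=
  G.IsForest S ∧ (G.sub S).Connected

/-- `S` is the edge set of a spanning two-forest: a forest on all of `V` with exactly two
connected components (one of them may be an isolated vertex). -/
def IsSpanningTwoForest (G : FeynmanDiagram V E W) (S : Set E) : Prop :=
  G.IsForest S ∧ Nat.card (G.sub S).ConnectedComponent = 2

open scoped Classical in
/-- The total external momentum entering the connected component of `v` in the spanning subgraph
with edge set `S`. -/
noncomputable def componentMomentum (G : FeynmanDiagram V E W) (S : Set E) (v : V) : W :=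
  ∑ w ∈ G.ext.filter (fun w => (G.sub S).Reachable v w), G.mom w

/-- `|p(F)|²` for a spanning two-forest `F = (T, T')` with edge set `S`. Here `T` is the component
of an arbitrary vertex; `momSq_eq` shows that the choice does not matter. -/
noncomputable def momSq [Nonempty V] (G : FeynmanDiagram V E W) (S : Set E) : ℝ :=
  G.form (G.componentMomentum S (Classical.arbitrary V))

theorem momSq_eq [Nonempty V] (G : FeynmanDiagram V E W) {S : Set E}
    (hS : G.IsSpanningTwoForest S) (v : V) :
    G.momSq S = G.form (G.componentMomentum S v) := by
  classical
  unfold momSq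
  set u : V := Classical.arbitrary V
  by_cases h : (G.sub S).Reachable u v
  · have : G.componentMomentum S u = G.componentMomentum S v := by
      unfold componentMomentum
      congr 1
      ext w
      simp only [Finset.mem_filter, and_congr_right_iff]
      exact fun _ => ⟨fun k => h.symm.trans k, fun k => h.trans k⟩
    rw [this]
  · have key : ∀ w, ¬ (G.sub S).Reachable u w ↔ (G.sub S).Reachable v w := by
      intro w
      constructor
      · intro hw
        by_contra hvw
        have h2 := hS.2
        rw [Nat.card_eq_two_iff] at h2
        obtain ⟨a, b, _, hab⟩ := h2
        have hmem : ∀ c, c = a ∨ c = b := fun c => by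
          have : c ∈ ({a, b} : Set _) := hab ▸ Set.mem_univ c
          simpa using this
        rw [← SimpleGraph.ConnectedComponent.eq] at h hw hvw
        rcases hmem ((G.sub S).connectedComponentMk u) with h1 | h1 <;>
        rcases hmem ((G.sub S).connectedComponentMk v) with h2 | h2 <;>
        rcases hmem ((G.sub S).connectedComponentMk w) with h3 | h3 <;>
        simp_all
      · intro hv hu
        exact h (hu.trans hv.symm)
    have hsum := Finset.sum_filter_add_sum_filter_not G.ext
      (fun w => (G.sub S).Reachable u w) G.mom
    rw [G.conservation] at hsum
    have : G.componentMomentum S u = - G.componentMomentum S v := by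
      unfold componentMomentum
      rw [eq_neg_iff_add_eq_zero, ← hsum]
      congr 2
      ext w
      simp [key w]
    rw [this, QuadraticMap.map_neg]

/-- The positivity convention for the momentum coefficients: either `form` is positive definite
(momenta are Wick rotated), or the momenta lie in the Euclidean region, `|p(F)|² > 0` for every
spanning two-forest `F`. -/
def IsEuclidean [Nonempty V] (G : FeynmanDiagram V E W) : Prop :=
  G.form.PosDef ∨ ∀ S : Set E, G.IsSpanningTwoForest S → 0 < G.momSq S

variable [Fintype E]

open scoped Classical in
/-- The monomial `∏_{e ∉ S} x_e`. -/
noncomputable def complMonomial (S : Finset E) : MvPolynomial E ℝ :=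
  ∏ e ∈ Sᶜ, MvPolynomial.X e

open scoped Classical in
/-- The first Symanzik polynomial `𝒰 = ∑_T ∏_{e ∉ T} x_e`, over the spanning trees `T`. -/
noncomputable def polyU (G : FeynmanDiagram V E W) : MvPolynomial E ℝ :=
  ∑ T ∈ Finset.univ.filter (fun T : Finset E => G.IsSpanningTree (T : Set E)), complMonomial T

open scoped Classical in
/-- `ℱ₀ = ∑_F |p(F)|² ∏_{e ∉ F} x_e`, over the spanning two-forests `F`. -/
noncomputable def polyF₀ [Nonempty V] (G : FeynmanDiagram V E W) : MvPolynomial E ℝ :=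
  ∑ S ∈ Finset.univ.filter (fun S : Finset E => G.IsSpanningTwoForest (S : Set E)),
    MvPolynomial.C (G.momSq (S : Set E)) * complMonomial S

/-- The second Symanzik polynomial `ℱ = 𝒰 ∑_e m_e² x_e + ℱ₀`. -/
noncomputable def polyF [Nonempty V] (G : FeynmanDiagram V E W) : MvPolynomial E ℝ :=
  G.polyU * (∑ e, MvPolynomial.C (G.mass e ^ 2) * MvPolynomial.X e) + G.polyF₀

/-- The Symanzik polytope `P_G`, the Newton polytope of the Lee–Pomeransky polynomial `𝒰 + ℱ`. -/
noncomputable def symanzikPolytope [Nonempty V] (G : FeynmanDiagram V E W) : Set (E → ℝ) :=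
  newtonPolytope (G.polyU + G.polyF)

/-- The number `L = |E| - |V| + 1` of independent cycles of a connected diagram. -/
def loopNumber [Fintype V] (_G : FeynmanDiagram V E W) : ℤ :=
  (Fintype.card E : ℤ) - (Fintype.card V : ℤ) + 1

end FeynmanDiagram

/-! Up to forgetting one coordinate, `P_G` is the base polytope of an M-convex set, and both the
decomposition property and the edge directions are general features of such polytopes.

Let `B` be a set of lattice points with the exchange property and constant coordinate sum. Minkowski
sums preserve exchange (`HasExchange.add`), and an exchange set contains every lattice point of its
hull (`HasExchange.mem_of_mem_convexHull`). Hence a lattice point of `kP` lies in the `k`-fold sum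
of `B`, which splits off a summand in `B`. Every edge of the hull has a direction `e_j - e_i`
(`HasExchange.edge_direction`); forgetting one coordinate turns these into columns of a network
matrix, which is unimodular (`det_network`).

The graph enters through its incidence vectors, extended by one vector `p : V → ℝ` of scalar momenta
with total zero. Bases of this configuration that avoid `p` are the spanning trees; those that
contain `p` are the two-forests on which `p` has nonzero component sum. The complements of bases
form an exchange set. In the massless case `p` can be chosen so that its component sums vanish on
the same two-forests as `|p(F)|²` (`IsEuclidean.exists_scalar_momenta`). In the massive case take `p
= 0` and add the unit vectors: every monomial of `ℱ₀` already occurs in `𝒰 ∑ m_e² x_e`. All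
coefficients are nonnegative, so nothing cancels. -/

/-! ### Exchange sets of lattice points -/

/-- The exchange property of an M-convex set (the lattice points of an integral base polytope). -/
def HasExchange {ι : Type*} [DecidableEq ι] (B : Set (ι → ℤ)) : Prop :=
  ∀ x ∈ B, ∀ y ∈ B, ∀ i, y i < x i →
    ∃ j, x j < y j ∧ x - Pi.single i 1 + Pi.single j 1 ∈ B

section Exchange

variable {ι : Type*} [Fintype ι] [DecidableEq ι]

/-- The `ℓ¹`-distance of two lattice points. -/
def latticeDist (x y : ι → ℤ) : ℕ := ∑ i, (x i - y i).natAbs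

theorem latticeDist_exchange_lt {x y : ι → ℤ} {i j : ι} (hi : y i < x i) (hj : x j < y j) :
    latticeDist (x - Pi.single i 1 + Pi.single j 1) y < latticeDist x y := by
  have hij : i ≠ j := by rintro rfl; omega
  refine Finset.sum_lt_sum (fun k _ => ?_) ⟨i, Finset.mem_univ _, ?_⟩
  · by_cases h1 : k = i
    · subst h1; simp [hij]; omega
    · by_cases h2 : k = j
      · subst h2; simp [h1]; omega
      · simp [h1, h2]
  · simp [hij]; omega

/-- Keep `u ∈ B`, `v ∈ C` with `u + v = x - e_i + e_j`. While `j` is not a valid answer, `u + v`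
exceeds `y` at `j`, so one summand exceeds its target there; exchanging in it moves the extra unit
from `j` to a new place and brings the pair closer to `(b', c')`. -/
theorem HasExchange.add {B C : Set (ι → ℤ)} (hB : HasExchange B) (hC : HasExchange C) :
    HasExchange (B + C) := by
  rintro x ⟨b, hb, c, hc, rfl⟩ y ⟨b', hb', c', hc', rfl⟩ i hi
  simp only at hi ⊢
  have key : ∀ (n : ℕ) (u v : ι → ℤ) (j : ι), u ∈ B → v ∈ C →
      u + v = b + c - Pi.single i 1 + Pi.single j 1 → (b' + c') j < (u + v) j →
      latticeDist u b' + latticeDist v c' = n →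
      ∃ j', (b + c) j' < (b' + c') j' ∧
        b + c - Pi.single i 1 + Pi.single j' 1 ∈ B + C := by
    intro n
    induction n using Nat.strong_induction_on with
    | _ n ih =>
      intro u v j hu hv huv hj hn
      have step : ∀ (u' v' : ι → ℤ) (j' : ι), u' ∈ B → v' ∈ C →
          u' + v' = u + v - Pi.single j 1 + Pi.single j' 1 →
          latticeDist u' b' + latticeDist v' c' < n →
          ∃ j', (b + c) j' < (b' + c') j' ∧
            b + c - Pi.single i 1 + Pi.single j' 1 ∈ B + C := by
        intro u' v' j' hu' hv' h hlt
        have h' : u' + v' = b + c - Pi.single i 1 + Pi.single j' 1 := by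
          rw [h, huv]; abel
        by_cases hj' : (b + c) j' < (b' + c') j'
        · exact ⟨j', hj', h' ▸ Set.add_mem_add hu' hv'⟩
        · refine ih _ hlt u' v' j' hu' hv' h' ?_ rfl
          rw [h']
          by_cases hji : j' = i
          · subst hji; simpa using hi
          · simp [hji] at hj' ⊢; omega
      by_cases hju : b' j < u j
      · obtain ⟨k, hk, hmem⟩ := hB u hu b' hb' j hju
        refine step _ v k hmem hv (by abel) ?_
        have := latticeDist_exchange_lt hju hk
        omega
      · have hjv : c' j < v j := by simp at hj; omega
        obtain ⟨k, hk, hmem⟩ := hC v hv c' hc' j hjv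
        refine step u _ k hu hmem (by abel) ?_
        have := latticeDist_exchange_lt hjv hk
        omega
  exact key _ b c i hb hc (by abel) hi rfl

omit [Fintype ι] in
theorem hasExchange_singleton (x : ι → ℤ) : HasExchange {x} := by
  rintro _ rfl _ rfl i hi
  exact absurd hi (lt_irrefl _)

omit [Fintype ι] in
theorem hasExchange_range_single :
    HasExchange (Set.range fun i : ι => (Pi.single i 1 : ι → ℤ)) := by
  rintro _ ⟨a, rfl⟩ _ ⟨b, rfl⟩ i hi
  have hia : i = a := by
    by_contra h
    simp only [Pi.single_apply, if_neg h] at hi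
    split_ifs at hi <;> omega
  subst hia
  have hib : b ≠ i := by rintro rfl; exact absurd hi (lt_irrefl _)
  exact ⟨b, by simp [hib], b, by simp⟩

-- Exchange `x - e_k + e_j` at `i` towards `x - e_i + e_k`: the only coordinate that may grow is
-- `k`, which cancels `-e_k`.
omit [Fintype ι] in
theorem HasExchange.sub_add_mem_trans {B : Set (ι → ℤ)} (hB : HasExchange B) {x : ι → ℤ}
    {i j k : ι} (hik : x - Pi.single i 1 + Pi.single k 1 ∈ B)
    (hkj : x - Pi.single k 1 + Pi.single j 1 ∈ B) (hij : i ≠ j) :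
    x - Pi.single i 1 + Pi.single j 1 ∈ B := by
  by_cases hki : k = i
  · rwa [hki] at hkj
  by_cases hjk : j = k
  · rwa [hjk]
  obtain ⟨l, hl, hmem⟩ := hB _ hkj _ hik i (by simp [Ne.symm hki, hij])
  have : l = k := by
    by_contra h
    simp only [Pi.add_apply, Pi.sub_apply, Pi.single_apply, if_neg h] at hl
    split_ifs at hl <;> omega
  subst this
  convert hmem using 1
  abel

omit [Fintype ι] in
theorem sum_exchange (R : Finset ι) (x : ι → ℤ) (i j : ι) :
    ∑ k ∈ R, (x - Pi.single i 1 + Pi.single j 1 : ι → ℤ) k =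
      ∑ k ∈ R, x k - (if i ∈ R then 1 else 0) + (if j ∈ R then 1 else 0) := by
  simp [Finset.sum_add_distrib, Finset.sum_sub_distrib, Pi.single_apply]

/-- The set of elements that can replace `i` in `x` is tight at `x`. -/
theorem HasExchange.sum_le_sum {B : Set (ι → ℤ)} (hB : HasExchange B) {x : ι → ℤ} (hx : x ∈ B)
    {i : ι} {R : Finset ι} (hR : ∀ j, j ∈ R ↔ x - Pi.single i 1 + Pi.single j 1 ∈ B)
    {y : ι → ℤ} (hy : y ∈ B) : ∑ k ∈ R, x k ≤ ∑ k ∈ R, y k := by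
  induction hn : latticeDist y x using Nat.strong_induction_on generalizing y with
  | _ n ih =>
    by_contra! hlt
    obtain ⟨k, hkR, hk⟩ := Finset.exists_lt_of_sum_lt hlt
    obtain ⟨j, hj, hmem⟩ := hB x hx y hy k hk
    have hjR : j ∈ R := by
      by_cases hij : i = j
      · subst hij; rw [hR]; simpa using hx
      · rw [hR] at hkR ⊢
        exact hB.sub_add_mem_trans hkR hmem hij
    -- As `j ∈ R`, removing `e_j` from `y` and adding `e_l` cannot raise the sum over `R`, and the
    -- result is nearer to `x`.
    obtain ⟨l, hl, hmem'⟩ := hB y hy x hx j hj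
    have h1 := ih _ (hn ▸ latticeDist_exchange_lt hj hl) hmem' rfl
    rw [sum_exchange, if_pos hjR] at h1
    split_ifs at h1 <;> omega

/-- A lattice point that satisfies all the inequalities `z(R) ≥ min_B x(R)` lies in `B`. -/
theorem HasExchange.mem_of_forall_sum {B : Set (ι → ℤ)} (hB : HasExchange B) (hne : B.Nonempty)
    {c : ℤ} (hc : ∀ b ∈ B, ∑ i, b i = c) {z : ι → ℤ} (hz : ∑ i, z i = c)
    (h : ∀ R : Finset ι, ∃ b ∈ B, ∑ i ∈ R, b i ≤ ∑ i ∈ R, z i) : z ∈ B := by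
  classical
  obtain ⟨x, hx⟩ := hne
  induction hn : latticeDist x z using Nat.strong_induction_on generalizing x with
  | _ n ih =>
    by_cases hxz : x = z
    · exact hxz ▸ hx
    obtain ⟨i, hi⟩ : ∃ i, z i < x i := by
      by_contra! hle
      refine hxz (funext fun i => ?_)
      exact (Finset.sum_eq_sum_iff_of_le fun i _ => hle i).1 ((hc x hx).trans hz.symm) i
        (Finset.mem_univ i)
    let R : Finset ι := {j | x - Pi.single i 1 + Pi.single j 1 ∈ B}
    have hR : ∀ j, j ∈ R ↔ x - Pi.single i 1 + Pi.single j 1 ∈ B := by simp [R]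
    by_cases hj : ∃ j ∈ R, x j < z j
    · obtain ⟨j, hjR, hj⟩ := hj
      exact ih _ (hn ▸ latticeDist_exchange_lt hi hj) _ ((hR j).1 hjR) rfl
    -- Now `z ≤ x` on `R`, strictly at `i ∈ R`, although `x` already attains the minimum over `R`.
    · push Not at hj
      obtain ⟨b, hb, hle⟩ := h R
      have h1 := hB.sum_le_sum hx hR hb
      have h2 : ∑ k ∈ R, z k < ∑ k ∈ R, x k :=
        Finset.sum_lt_sum hj ⟨i, (hR i).2 (by simpa using hx), hi⟩
      omega

/-- The real points of a set of lattice points. -/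
def realPoints (B : Set (ι → ℤ)) : Set (ι → ℝ) := (fun z i => (z i : ℝ)) '' B

omit [Fintype ι] [DecidableEq ι] in
theorem realPoints_add (B C : Set (ι → ℤ)) :
    realPoints (B + C) = realPoints B + realPoints C := by
  ext x
  simp only [realPoints, Set.mem_image, Set.mem_add]
  constructor
  · rintro ⟨_, ⟨b, hb, c, hc, rfl⟩, rfl⟩
    exact ⟨_, ⟨b, hb, rfl⟩, _, ⟨c, hc, rfl⟩, by ext; simp⟩
  · rintro ⟨_, ⟨b, hb, rfl⟩, _, ⟨c, hc, rfl⟩, rfl⟩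
    exact ⟨_, ⟨b, hb, c, hc, rfl⟩, by ext; simp⟩

/-- A linear functional that is at least `t` on a set is at least `t` on its convex hull. -/
theorem le_apply_of_mem_convexHull {κ : Type*} {S : Set (κ → ℝ)} (f : (κ → ℝ) →ₗ[ℝ] ℝ) {t : ℝ}
    (h : ∀ s ∈ S, t ≤ f s) {x : κ → ℝ} (hx : x ∈ convexHull ℝ S) : t ≤ f x :=
  convexHull_min (t := {y | t ≤ f y}) h (convex_halfSpace_ge f.isLinear t) hx

/-- The functional `x ↦ x(R)`. -/
noncomputable def sumOver {κ : Type*} (R : Finset κ) : (κ → ℝ) →ₗ[ℝ] ℝ :=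
  ∑ i ∈ R, LinearMap.proj i

theorem sumOver_apply {κ : Type*} (R : Finset κ) (x : κ → ℝ) : sumOver R x = ∑ i ∈ R, x i := by
  simp [sumOver]

omit [DecidableEq ι] in
theorem sum_eq_of_mem_convexHull {B : Set (ι → ℤ)} {c : ℤ} (hc : ∀ b ∈ B, ∑ i, b i = c)
    {x : ι → ℝ} (hx : x ∈ convexHull ℝ (realPoints B)) : ∑ i, x i = c := by
  have hs : ∀ s ∈ realPoints B, sumOver Finset.univ s = (c : ℝ) := by
    rintro _ ⟨b, hb, rfl⟩
    rw [sumOver_apply, ← hc b hb]; push_cast; rfl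
  rw [← sumOver_apply]
  refine le_antisymm ?_ (le_apply_of_mem_convexHull _ (fun s h => (hs s h).ge) hx)
  have := le_apply_of_mem_convexHull (-sumOver Finset.univ) (t := -(c : ℝ))
    (fun s h => by simp [hs s h]) hx
  simpa using this

/-- Exchange sets contain all the lattice points of their convex hulls. -/
theorem HasExchange.mem_of_mem_convexHull {B : Set (ι → ℤ)} (hB : HasExchange B)
    {c : ℤ} (hc : ∀ b ∈ B, ∑ i, b i = c) {z : ι → ℤ}
    (hz : (fun i => (z i : ℝ)) ∈ convexHull ℝ (realPoints B)) : z ∈ B := by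
  have hne : B.Nonempty := by
    obtain ⟨_, b, hb, _⟩ := convexHull_nonempty_iff.1 ⟨_, hz⟩
    exact ⟨b, hb⟩
  refine hB.mem_of_forall_sum hne hc ?_ fun R => ?_
  · exact_mod_cast sum_eq_of_mem_convexHull hc hz
  · by_contra! hlt
    -- By integrality the strict inequality is a gap of at least one, and a weak inequality passes
    -- to the hull.
    have h := le_apply_of_mem_convexHull (sumOver R) (t := ((∑ i ∈ R, z i + 1 : ℤ) : ℝ)) (by
      rintro _ ⟨b, hb, rfl⟩
      rw [sumOver_apply, ← Int.cast_sum, Int.cast_le]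
      exact hlt b hb) hz
    rw [sumOver_apply] at h
    norm_cast at h
    omega

/-- The `k`-fold Minkowski sum of a set of lattice points. -/
def iteratedSum (B : Set (ι → ℤ)) : ℕ → Set (ι → ℤ)
  | 0 => {0}
  | k + 1 => iteratedSum B k + B

theorem HasExchange.iteratedSum {B : Set (ι → ℤ)} (hB : HasExchange B) (k : ℕ) :
    HasExchange (iteratedSum B k) := by
  induction k with
  | zero => exact hasExchange_singleton 0
  | succ k ih => exact ih.add hB

omit [DecidableEq ι] in
theorem sum_iteratedSum {B : Set (ι → ℤ)} {c : ℤ} (hc : ∀ b ∈ B, ∑ i, b i = c) (k : ℕ) :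
    ∀ b ∈ iteratedSum B k, ∑ i, b i = k * c := by
  induction k with
  | zero => rintro _ rfl; simp
  | succ k ih =>
    rintro _ ⟨a, ha, b, hb, rfl⟩
    simp [Finset.sum_add_distrib, ih a ha, hc b hb]; ring

-- Nonemptiness is needed at `k = 0` only: the empty sum is `{0}`, but `0 • ∅ = ∅`.
omit [Fintype ι] [DecidableEq ι] in
theorem convexHull_iteratedSum {B : Set (ι → ℤ)} (hne : B.Nonempty) (k : ℕ) :
    convexHull ℝ (realPoints (iteratedSum B k)) = (k : ℝ) • convexHull ℝ (realPoints B) := by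
  have hne' : (convexHull ℝ (realPoints B)).Nonempty := (hne.image _).convexHull
  induction k with
  | zero =>
    have : realPoints ({0} : Set (ι → ℤ)) = {0} := by
      simp [realPoints]; rfl
    rw [_root_.iteratedSum, this, convexHull_singleton, Nat.cast_zero, Set.zero_smul_set hne',
      Set.singleton_zero]
  | succ k ih =>
    rw [_root_.iteratedSum, realPoints_add, convexHull_add, ih, Nat.cast_add, Nat.cast_one,
      (convex_convexHull ℝ _).add_smul (Nat.cast_nonneg k) zero_le_one, one_smul]

theorem add_mem_latticePoints {κ : Type*} {x y : κ → ℝ} (hx : x ∈ latticePoints κ)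
    (hy : y ∈ latticePoints κ) : x + y ∈ latticePoints κ := by
  obtain ⟨a, rfl⟩ := hx
  obtain ⟨b, rfl⟩ := hy
  exact ⟨a + b, by ext; simp⟩

/-- For convex sets only one inclusion in the integer decomposition property is at stake. -/
theorem isIDP_of_subset {κ : Type*} {P : Set (κ → ℝ)} (hP : Convex ℝ P)
    (h : ∀ k : ℕ, ((k + 1 : ℝ) • P) ∩ latticePoints κ ⊆
      (((k : ℝ) • P) ∩ latticePoints κ) + (P ∩ latticePoints κ)) : IsIDP P := by
  rintro (_ | k) hk
  · omega
  simp only [Nat.cast_add, Nat.cast_one, add_sub_cancel_right]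
  refine (h k).antisymm ?_
  rintro _ ⟨x, ⟨hx, hx'⟩, y, ⟨hy, hy'⟩, rfl⟩
  refine ⟨?_, add_mem_latticePoints hx' hy'⟩
  rw [hP.add_smul (Nat.cast_nonneg k) zero_le_one, one_smul]
  exact Set.add_mem_add hx hy

theorem IsIDP.subset {κ : Type*} {P : Set (κ → ℝ)} (h : IsIDP P) (k : ℕ) :
    ((k + 1 : ℝ) • P) ∩ latticePoints κ ⊆
      (((k : ℝ) • P) ∩ latticePoints κ) + (P ∩ latticePoints κ) := by
  have := h (k + 1) (by omega)
  simp only [Nat.cast_add, Nat.cast_one, add_sub_cancel_right] at this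
  exact this.subset

/-- The convex hull of an exchange set has the integer decomposition property. -/
theorem HasExchange.isIDP {B : Set (ι → ℤ)} (hB : HasExchange B)
    {c : ℤ} (hc : ∀ b ∈ B, ∑ i, b i = c) : IsIDP (convexHull ℝ (realPoints B)) := by
  rcases B.eq_empty_or_nonempty with rfl | hne
  · simp [realPoints, IsIDP]
  refine isIDP_of_subset (convex_convexHull ℝ _) fun k => ?_
  rintro _ ⟨hz, z, rfl⟩
  have hz' : z ∈ _root_.iteratedSum B (k + 1) := by
    refine (hB.iteratedSum (k + 1)).mem_of_mem_convexHull (sum_iteratedSum hc _) ?_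
    rw [convexHull_iteratedSum hne]
    exact_mod_cast hz
  obtain ⟨a, ha, b, hb, rfl⟩ := hz'
  refine ⟨_, ⟨?_, a, rfl⟩, _, ⟨subset_convexHull ℝ _ ⟨b, hb, rfl⟩, b, rfl⟩, by ext; simp⟩
  rw [← convexHull_iteratedSum hne]
  exact subset_convexHull ℝ _ ⟨a, ha, rfl⟩

omit [Fintype ι] [DecidableEq ι] in
theorem left_mem_extremePoints_segment {x y : ι → ℝ} (hxy : x ≠ y) :
    x ∈ (segment ℝ x y).extremePoints ℝ := by
  refine ⟨left_mem_segment ℝ x y, ?_⟩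
  intro a ha b hb hab
  rw [segment_eq_image'] at ha hb
  obtain ⟨s, ⟨hs, -⟩, rfl⟩ := ha
  obtain ⟨t, ⟨ht, -⟩, rfl⟩ := hb
  obtain ⟨α, β, hα, hβ, hαβ, h⟩ := hab
  have h0 : (α * s + β * t) • (y - x) = 0 := by
    have : α • (x + s • (y - x)) + β • (x + t • (y - x)) =
      (α + β) • x + (α * s + β * t) • (y - x) := by module
    rw [this, hαβ, one_smul] at h
    simpa using h
  have h1 : α * s + β * t = 0 := (smul_eq_zero.1 h0).resolve_right (sub_ne_zero.2 hxy.symm)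
  have h2 : s = 0 := by
    have h3 : 0 ≤ β * t := by positivity
    have h4 : 0 ≤ α * s := by positivity
    have h5 : α * s = 0 := by linarith
    exact (mul_eq_zero.1 h5).resolve_left hα.ne'
  simp [h2]

/-- The edges of the convex hull of an exchange set are parallel to differences of unit vectors. -/
theorem HasExchange.edge_direction {B : Set (ι → ℤ)} (hB : HasExchange B) {x y : ι → ℝ}
    (h : IsEdgeOf (convexHull ℝ (realPoints B)) x y) :
    ∃ (i j : ι) (t : ℝ), y - x = t • (Pi.single j 1 - Pi.single i 1 : ι → ℝ) := by
  obtain ⟨hxy, hexp⟩ := h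
  have hmem : ∀ w, w ∈ (segment ℝ x y).extremePoints ℝ → w ∈ realPoints B := fun w hw =>
    extremePoints_convexHull_subset (hexp.isExtreme.extremePoints_subset_extremePoints hw)
  obtain ⟨b, hb, rfl⟩ := hmem x (left_mem_extremePoints_segment hxy)
  obtain ⟨b', hb', rfl⟩ := hmem y (by
    rw [segment_symm]; exact left_mem_extremePoints_segment hxy.symm)
  obtain ⟨l, hl⟩ := hexp ⟨_, left_mem_segment ℝ _ _⟩
  have hcast : ∀ (z : ι → ℤ) (i j : ι),
      (fun k => ((z - Pi.single i 1 + Pi.single j 1 : ι → ℤ) k : ℝ)) =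
        (fun k => (z k : ℝ)) - Pi.single i 1 + Pi.single j 1 := by
    intro z i j; ext k; simp [Pi.single_apply]
  have hmax : ∀ z ∈ segment ℝ (fun i => (b i : ℝ)) (fun i => (b' i : ℝ)),
      ∀ p ∈ convexHull ℝ (realPoints B), l p ≤ l z := fun z hz => (hl.subset hz).2
  have hw : ∀ z : ι → ℤ, (fun k => (z k : ℝ)) ∈
      segment ℝ (fun i => (b i : ℝ)) (fun i => (b' i : ℝ)) → ∀ i j,
      z - Pi.single i 1 + Pi.single j 1 ∈ B → l (Pi.single j 1) ≤ l (Pi.single i 1) := by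
    intro z hz i j hz'
    have := hmax _ hz _ (subset_convexHull ℝ _ ⟨_, hz', rfl⟩)
    simp only [hcast, map_add, map_sub] at this
    linarith
  have hex1 : ∀ i, b' i < b i → ∃ j, b j < b' j ∧ b - Pi.single i 1 + Pi.single j 1 ∈ B :=
    hB b hb b' hb'
  have hex2 : ∀ i, b i < b' i → ∃ j, b' j < b j ∧ b' - Pi.single i 1 + Pi.single j 1 ∈ B :=
    hB b' hb' b hb
  have hI : (Finset.univ.filter fun i => b' i < b i).Nonempty := by
    by_contra hne
    rw [Finset.not_nonempty_iff_eq_empty, Finset.filter_eq_empty_iff] at hne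
    obtain ⟨i, hi⟩ : ∃ i, b i ≠ b' i := by
      by_contra! hall
      exact hxy (funext fun i => congrArg _ (hall i))
    have hlt : b i < b' i := lt_of_le_of_ne (not_lt.1 (hne (Finset.mem_univ i))) hi
    obtain ⟨j, hj, -⟩ := hex2 i hlt
    exact hne (Finset.mem_univ j) hj
  -- With `i` and `j'` of least `l`-value on their sides, exchanges at both ends give `l e_i ≤ l
  -- e_i' ≤ l e_j' ≤ l e_j ≤ l e_i`. So `b - e_i + e_j` also maximizes `l` and lies on the edge.
  obtain ⟨i, hi, himin⟩ := Finset.exists_min_image _ (fun i => l (Pi.single i 1)) hI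
  simp only [Finset.mem_filter, Finset.mem_univ, true_and] at hi himin
  obtain ⟨j, hj, hjB⟩ := hex1 i hi
  have hJ : (Finset.univ.filter fun i => b i < b' i).Nonempty := ⟨j, by simpa using hj⟩
  obtain ⟨j', hj', hj'min⟩ := Finset.exists_min_image _ (fun i => l (Pi.single i 1)) hJ
  simp only [Finset.mem_filter, Finset.mem_univ, true_and] at hj' hj'min
  obtain ⟨i', hi', hi'B⟩ := hex2 j' hj'
  have h1 := hw b (left_mem_segment ℝ _ _) _ _ hjB
  have h2 := hw b' (right_mem_segment ℝ _ _) _ _ hi'B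
  have h3 := himin i' hi'
  have h4 := hj'min j hj
  have hp : (fun k => ((b - Pi.single i 1 + Pi.single j 1 : ι → ℤ) k : ℝ)) ∈
      segment ℝ (fun i => (b i : ℝ)) (fun i => (b' i : ℝ)) := by
    rw [hl]
    refine ⟨subset_convexHull ℝ _ ⟨_, hjB, rfl⟩, fun p hp => ?_⟩
    have := hmax _ (left_mem_segment ℝ _ _) p hp
    rw [hcast, map_add, map_sub]
    linarith
  rw [segment_eq_image'] at hp
  obtain ⟨t, -, ht⟩ := hp
  simp only [hcast] at ht
  have ht' : t • ((fun i => (b' i : ℝ)) - (fun i => (b i : ℝ))) =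
      (Pi.single j 1 - Pi.single i 1 : ι → ℝ) := by
    have := congrArg (fun p => p - (fun i => (b i : ℝ))) ht
    simp only [add_sub_cancel_left] at this
    rw [this]; abel
  have hij : i ≠ j := by rintro rfl; omega
  have ht0 : t ≠ 0 := by
    rintro rfl
    have := congrFun ht' j
    simp [hij.symm] at this
  exact ⟨i, j, t⁻¹, by rw [← ht', smul_smul, inv_mul_cancel₀ ht0, one_smul]⟩

end Exchange

/-! ### Projections and lifts -/

section Projection

variable {ι : Type*} [Fintype ι]

/-- Forgetting the additional coordinate. -/
def forgetCoord (ι : Type*) : (Option ι → ℝ) →ₗ[ℝ] (ι → ℝ) := LinearMap.funLeft ℝ ℝ some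

omit [Fintype ι] in
theorem forgetCoord_apply (x : Option ι → ℝ) (i : ι) : forgetCoord ι x i = x (some i) := rfl

theorem eq_of_forgetCoord_eq {x y : Option ι → ℝ} (h : forgetCoord ι x = forgetCoord ι y)
    (hs : ∑ o, x o = ∑ o, y o) : x = y := by
  have h' : ∀ i, x (some i) = y (some i) := fun i => congrFun h i
  ext (_ | i)
  · simpa [Fintype.sum_option, h'] using hs
  · exact h' i

/-- The forgotten coordinate is the integral total minus the others, so lattice points of dilates
lift to lattice points. -/
theorem IsIDP.forgetCoord {P : Set (Option ι → ℝ)} (hP : Convex ℝ P) (h : IsIDP P) {c : ℤ}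
    (hc : ∀ x ∈ P, ∑ o, x o = c) : IsIDP (forgetCoord ι '' P) := by
  refine isIDP_of_subset (hP.linear_image _) fun k => ?_
  rintro _ ⟨⟨_, ⟨p, hp, rfl⟩, rfl⟩, z, hz⟩
  simp only at hz
  have hz' : ∀ i, (z i : ℝ) = (k + 1 : ℝ) * p (some i) := fun i => congrFun hz i
  have hmem : (k + 1 : ℝ) • p ∈ latticePoints (Option ι) := by
    refine ⟨fun o => o.elim ((k + 1) * c - ∑ i, z i) z, ?_⟩
    ext (_ | i)
    · have h1 := hc p hp
      rw [Fintype.sum_option] at h1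
      simp [hz', ← Finset.mul_sum, ← h1]
      ring
    · simp [hz']
  obtain ⟨_, ⟨⟨a, ha, rfl⟩, a', ha'⟩, b, ⟨hb, b', hb'⟩, hab⟩ :=
    h.subset k ⟨Set.smul_mem_smul_set hp, hmem⟩
  refine ⟨_, ⟨⟨_, ⟨a, ha, rfl⟩, rfl⟩, fun i => a' (some i), ?_⟩, _,
    ⟨⟨b, hb, rfl⟩, fun i => b' (some i), ?_⟩, ?_⟩
  · ext i; exact congrFun ha' (some i)
  · ext i; exact congrFun hb' (some i)
  · ext i; exact congrFun hab (some i)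

/-- The affine map `y ↦ (y, f y + t)`. -/
noncomputable def appendAffine (f : (ι → ℝ) →ₗ[ℝ] ℝ) (t : ℝ) : (ι → ℝ) →ᵃ[ℝ] (Option ι → ℝ) :=
  (LinearMap.pi fun o : Option ι => o.elim f LinearMap.proj).toAffineMap +
    AffineMap.const ℝ _ (fun o : Option ι => o.elim t 0)

omit [Fintype ι] in
theorem appendAffine_apply (f : (ι → ℝ) →ₗ[ℝ] ℝ) (t : ℝ) (y : ι → ℝ) :
    appendAffine f t y = appendCoord y (f y + t) := by
  ext (_ | i) <;> simp [appendAffine, appendCoord]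

theorem IsIDP.appendCoord {P : Set (ι → ℝ)} (hP : Convex ℝ P) (h : IsIDP P) (L : ℤ) :
    IsIDP ((fun y => appendCoord y (∑ i, y i - (L : ℝ))) '' P) := by
  have hfun : (fun y : ι → ℝ => _root_.appendCoord y (∑ i, y i - (L : ℝ))) =
      appendAffine (sumOver Finset.univ) (-(L : ℝ)) := by
    ext1 y
    rw [appendAffine_apply, sumOver_apply, sub_eq_add_neg]
  refine isIDP_of_subset (by rw [hfun]; exact hP.affine_image _) fun k => ?_
  rintro _ ⟨⟨_, ⟨y, hy, rfl⟩, rfl⟩, z, hz⟩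
  have hmem : (k + 1 : ℝ) • y ∈ latticePoints ι :=
    ⟨fun i => z (some i), by ext i; exact congrFun hz (some i)⟩
  obtain ⟨_, ⟨⟨a, ha, rfl⟩, a', ha'⟩, b, ⟨hb, b', hb'⟩, hab⟩ :=
    h.subset k ⟨Set.smul_mem_smul_set hy, hmem⟩
  have ha1 : ∀ i, (a' i : ℝ) = k * a i := fun i => congrFun ha' i
  have hb1 : ∀ i, (b' i : ℝ) = b i := fun i => congrFun hb' i
  have hab1 : ∀ i, k * a i + b i = (k + 1) * y i := fun i => congrFun hab i
  -- The constant is `k * L` because the affine height is dilated along with `a`.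
  refine ⟨_, ⟨⟨_, ⟨a, ha, rfl⟩, rfl⟩, fun o => o.elim (∑ i, a' i - k * L) a', ?_⟩, _,
    ⟨⟨b, hb, rfl⟩, fun o => o.elim (∑ i, b' i - L) b', ?_⟩, ?_⟩
  · ext (_ | i)
    · simp [_root_.appendCoord, ha1, ← Finset.mul_sum]; ring
    · simp [_root_.appendCoord, ha1]
  · ext (_ | i)
    · simp [_root_.appendCoord, hb1]
    · simp [_root_.appendCoord, hb1]
  · ext (_ | i)
    · have : ∑ i, (k * a i + b i) = ∑ i, (k + 1) * y i := Finset.sum_congr rfl fun i _ => hab1 i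
      rw [Finset.sum_add_distrib, ← Finset.mul_sum, ← Finset.mul_sum] at this
      simp [_root_.appendCoord]
      linarith
    · simpa [_root_.appendCoord] using hab1 i

/-- The projection is injective on the hyperplane of sum `c`, so the exposing functional can be
pulled back. -/
theorem IsEdgeOf.of_forgetCoord {P : Set (Option ι → ℝ)} {c : ℝ}
    (hP : Convex ℝ P) (hc : ∀ x ∈ P, ∑ o, x o = c) {x y : Option ι → ℝ} (hx : x ∈ P) (hy : y ∈ P)
    (h : IsEdgeOf (forgetCoord ι '' P) (forgetCoord ι x) (forgetCoord ι y)) : IsEdgeOf P x y := by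
  obtain ⟨hxy, hexp⟩ := h
  refine ⟨fun h => hxy (by rw [h]), fun _ => ?_⟩
  obtain ⟨l, hl⟩ := hexp ⟨_, left_mem_segment ℝ _ _⟩
  have hsub : segment ℝ x y ⊆ P := hP.segment_subset hx hy
  have himg := image_segment ℝ (forgetCoord ι).toAffineMap x y
  simp only [LinearMap.coe_toAffineMap] at himg
  refine ⟨l.comp (LinearMap.toContinuousLinearMap (forgetCoord ι)), ?_⟩
  ext p
  constructor
  · intro hp
    have : forgetCoord ι p ∈ segment ℝ (forgetCoord ι x) (forgetCoord ι y) :=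
      himg ▸ Set.mem_image_of_mem _ hp
    rw [hl] at this
    exact ⟨hsub hp, fun q hq => this.2 _ ⟨q, hq, rfl⟩⟩
  · rintro ⟨hp, hmax⟩
    have : forgetCoord ι p ∈ segment ℝ (forgetCoord ι x) (forgetCoord ι y) := by
      rw [hl]
      refine ⟨⟨p, hp, rfl⟩, ?_⟩
      rintro _ ⟨q, hq, rfl⟩
      exact hmax q hq
    rw [← himg] at this
    obtain ⟨q, hq, hqp⟩ := this
    rwa [← eq_of_forgetCoord_eq hqp ((hc q (hsub hq)).trans (hc p hp).symm)]

end Projection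

/-! ### Network matrices -/

/-- If every column has both ends among the row labels, the rows sum to zero. Otherwise some column
has at most one nonzero entry, equal to `±1`, and expanding along it leaves a smaller matrix of the
same kind. -/
theorem det_network {α : Type*} [DecidableEq α] : ∀ {n : ℕ} (lab : Fin n → α)
    (_ : Function.Injective lab) (a b : Fin n → α) (A : Matrix (Fin n) (Fin n) ℤ)
    (_ : ∀ i j, A i j = (if a j = lab i then 1 else 0) - (if b j = lab i then 1 else 0)),
    A.det = 0 ∨ A.det = 1 ∨ A.det = -1
  | 0, _, _, _, _, A, _ => by simp
  | n + 1, lab, hlab, a, b, A, hA => by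
    have hsum : ∀ c : α, c ∈ Set.range lab → ∑ i, (if c = lab i then (1 : ℤ) else 0) = 1 := by
      rintro _ ⟨k, rfl⟩
      simp [hlab.eq_iff]
    by_cases hall : ∀ j, a j ∈ Set.range lab ∧ b j ∈ Set.range lab
    · left
      refine Matrix.exists_vecMul_eq_zero_iff.1 ⟨1, one_ne_zero, ?_⟩
      ext j
      simp [Matrix.vecMul, dotProduct, hA, hsum _ (hall j).1, hsum _ (hall j).2]
    · push Not at hall
      obtain ⟨j, hj⟩ := hall
      obtain ⟨s, c, hs, hc⟩ : ∃ (s : ℤ) (c : α), (s = 1 ∨ s = -1) ∧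
          ∀ i, A i j = if c = lab i then s else 0 := by
        by_cases haj : a j ∈ Set.range lab
        · refine ⟨1, a j, Or.inl rfl, fun i => ?_⟩
          have : b j ≠ lab i := fun h => hj haj ⟨i, h.symm⟩
          simp [hA, this]
        · refine ⟨-1, b j, Or.inr rfl, fun i => ?_⟩
          have : a j ≠ lab i := fun h => haj ⟨i, h.symm⟩
          simp only [hA, if_neg this]
          split_ifs <;> simp
      rw [Matrix.det_succ_column A j]
      by_cases hcr : c ∈ Set.range lab
      · obtain ⟨k, rfl⟩ := hcr
        rw [Finset.sum_eq_single k]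
        · have ih := det_network (lab ∘ k.succAbove) (hlab.comp Fin.succAbove_right_injective)
            (a ∘ j.succAbove) (b ∘ j.succAbove) (A.submatrix k.succAbove j.succAbove)
            (fun _ _ => hA _ _)
          rw [hc, if_pos rfl]
          rcases neg_one_pow_eq_or ℤ (k + j : ℕ) with h | h <;> rw [h] <;>
          rcases hs with rfl | rfl <;> rcases ih with h | h | h <;> rw [h] <;> simp
        · intro i _ hik
          rw [hc, if_neg (fun h => hik (hlab h).symm)]
          simp
        · simp
      · left
        refine Finset.sum_eq_zero fun i _ => ?_
        rw [hc, if_neg (fun h => hcr ⟨i, h.symm⟩)]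
        simp

open scoped Classical in
/-- The matrix whose columns are the vectors `e_a - e_b`, where `e_none = 0`. -/
noncomputable def networkMatrix (ι : Type*) [Fintype ι] :
    Matrix ι (Fin (Fintype.card (Option ι × Option ι))) ℤ := fun i k =>
  (if ((Fintype.equivFin (Option ι × Option ι)).symm k).1 = some i then 1 else 0) -
    (if ((Fintype.equivFin (Option ι × Option ι)).symm k).2 = some i then 1 else 0)

theorem isUnimodularMatrix_networkMatrix (ι : Type*) [Fintype ι] :
    IsUnimodularMatrix (networkMatrix ι) := by
  classical
  constructor
  · refine le_antisymm (Matrix.rank_le_card_height _) ?_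
    -- `R` selects the columns `(some i, none)`, which are the unit vectors, and so is a right
    -- inverse.
    let R : Matrix (Fin (Fintype.card (Option ι × Option ι))) ι ℚ := fun k i =>
      if k = Fintype.equivFin _ (some i, none) then 1 else 0
    have h : (networkMatrix ι).map (fun z : ℤ => (z : ℚ)) * R = 1 := by
      ext i j
      rw [Matrix.mul_apply, Finset.sum_eq_single (Fintype.equivFin _ (some j, none))]
      · simp [R, networkMatrix, Matrix.one_apply, eq_comm (a := i)]
      · intro k _ hk
        simp [R, hk]
      · simp
    calc Fintype.card ι = (1 : Matrix ι ι ℚ).rank := Matrix.rank_one.symm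
      _ ≤ _ := by rw [← h]; exact Matrix.rank_mul_le_left _ _
  · intro c
    have := det_network (fun k => some ((Fintype.equivFin ι).symm k))
      (fun _ _ h => (Fintype.equivFin ι).symm.injective (Option.some_injective _ h))
      (fun k => ((Fintype.equivFin (Option ι × Option ι)).symm
        (c ((Fintype.equivFin ι).symm k))).1)
      (fun k => ((Fintype.equivFin (Option ι × Option ι)).symm
        (c ((Fintype.equivFin ι).symm k))).2)
      (((networkMatrix ι).submatrix id c).submatrix (Fintype.equivFin ι).symm
        (Fintype.equivFin ι).symm) (fun i j => by simp [networkMatrix])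
    rw [Matrix.det_submatrix_equiv_self] at this
    convert this

theorem HasExchange.isEdgeUnimodular {ι : Type*} [Fintype ι] [DecidableEq (Option ι)]
    {B : Set (Option ι → ℤ)} (hB : HasExchange B)
    {c : ℤ} (hc : ∀ b ∈ B, ∑ i, b i = c) :
    IsEdgeUnimodular (forgetCoord ι '' convexHull ℝ (realPoints B)) := by
  refine ⟨_, networkMatrix ι, isUnimodularMatrix_networkMatrix ι, fun x y hxy => ?_⟩
  obtain ⟨x, hx, rfl⟩ : x ∈ forgetCoord ι '' convexHull ℝ (realPoints B) :=
    hxy.2.subset (left_mem_segment ℝ _ _)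
  obtain ⟨y, hy, rfl⟩ : y ∈ forgetCoord ι '' convexHull ℝ (realPoints B) :=
    hxy.2.subset (right_mem_segment ℝ _ _)
  obtain ⟨a, b, t, h⟩ := hB.edge_direction (hxy.of_forgetCoord (convex_convexHull ℝ _)
    (fun _ => sum_eq_of_mem_convexHull hc) hx hy)
  refine ⟨Fintype.equivFin _ (b, a), t, ?_⟩
  rw [← map_sub, h]
  ext i
  simp [forgetCoord_apply, networkMatrix, Pi.single_apply, eq_comm]

/-! ### Bases of a vector configuration -/

section VectorConfiguration

variable {α M : Type*} [AddCommGroup M] [Module ℝ M]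

/-- The vectors indexed by `S` form a basis of the span of the configuration `v`. -/
def IsVectorBase (v : α → M) (S : Set α) : Prop :=
  LinearIndepOn ℝ v S ∧ ∀ a, v a ∈ Submodule.span ℝ (v '' S)

/-- Take `R` maximal between `S ∩ S'` and `S` with `v i` outside its span. Any `j ∈ S \ R` works: by
maximality `v i` and `v j` are interchangeable modulo the span of `R`, and `R ⊆ S \ {j}`. -/
theorem IsVectorBase.exchange {v : α → M} {S S' : Set α} (hS : IsVectorBase v S)
    (hS' : LinearIndepOn ℝ v S') {i : α} (hi : i ∈ S') (hiS : i ∉ S) :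
    ∃ j ∈ S, j ∉ S' ∧ IsVectorBase v (insert i (S \ {j})) := by
  have hi' : v i ∉ Submodule.span ℝ (v '' (S ∩ S')) := fun h =>
    linearIndepOn_iff_notMem_span.1 hS' i hi
      (Submodule.span_mono (Set.image_mono (show S ∩ S' ⊆ S' \ {i} from
        fun a ha => ⟨ha.2, fun h => hiS (h ▸ ha.1)⟩)) h)
  obtain ⟨R, hRS, hR⟩ := zorn_subset_nonempty
    {R | S ∩ S' ⊆ R ∧ R ⊆ S ∧ v i ∉ Submodule.span ℝ (v '' R)} (by
      intro c hc hchain hne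
      refine ⟨⋃₀ c, ⟨?_, Set.sUnion_subset fun R hR => (hc hR).2.1, ?_⟩,
        fun R hR => Set.subset_sUnion_of_mem hR⟩
      · obtain ⟨R, hR⟩ := hne
        exact (hc hR).1.trans (Set.subset_sUnion_of_mem hR)
      · rw [Set.sUnion_eq_biUnion, Set.image_iUnion₂, Submodule.span_iUnion₂, iSup_subtype']
        have : Nonempty c := hne.to_subtype
        rw [Submodule.mem_iSup_of_directed]
        · rintro ⟨R, hR⟩
          exact (hc R.2).2.2 hR
        · intro a b
          rcases hchain.total a.2 b.2 with h | h
          · exact ⟨b, Submodule.span_mono (Set.image_mono h), le_rfl⟩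
          · exact ⟨a, le_rfl, Submodule.span_mono (Set.image_mono h)⟩)
    (S ∩ S') ⟨subset_rfl, Set.inter_subset_left, hi'⟩
  obtain ⟨⟨hR1, hR2, hR3⟩, hmax⟩ := hR
  obtain ⟨j, hjS, hjR⟩ : ∃ j ∈ S, j ∉ R := by
    by_contra! h
    exact hR3 (Submodule.span_mono (Set.image_mono h) (hS.2 i))
  have hins : v i ∈ Submodule.span ℝ (insert (v j) (v '' R)) := by
    by_contra h
    refine hjR (hmax (y := insert j R) ⟨hR1.trans (Set.subset_insert _ _),
      Set.insert_subset hjS hR2, by rwa [Set.image_insert_eq]⟩ (Set.subset_insert _ _)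
      (Set.mem_insert j R))
  have hj : v j ∈ Submodule.span ℝ (insert (v i) (v '' R)) :=
    mem_span_insert_exchange hins hR3
  have hsub : v '' R ⊆ v '' (S \ {j}) :=
    Set.image_mono (show R ⊆ S \ {j} from fun a ha => ⟨hR2 ha, fun h => hjR (h ▸ ha)⟩)
  have hj' : v j ∈ Submodule.span ℝ (v '' insert i (S \ {j})) := by
    rw [Set.image_insert_eq]
    exact Submodule.span_mono (Set.insert_subset_insert hsub) hj
  refine ⟨j, hjS, fun h => hjR (hR1 ⟨hjS, h⟩), ?_, fun a => ?_⟩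
  · refine (hS.1.mono Set.sdiff_subset).insert fun hi2 => ?_
    refine linearIndepOn_iff_notMem_span.1 hS.1 j hjS ?_
    refine Submodule.span_le.2 (Set.insert_subset hi2 ?_) hj
    exact hsub.trans Submodule.subset_span
  · refine Submodule.span_le.2 ?_ (hS.2 a)
    rintro _ ⟨s, hs, rfl⟩
    by_cases hsj : s = j
    · rw [hsj]; exact hj'
    · exact Submodule.subset_span ⟨s, Or.inr ⟨hs, hsj⟩, rfl⟩

theorem IsVectorBase.ncard [Finite α] {v : α → M} {S : Set α} (hS : IsVectorBase v S) :
    S.ncard = Module.finrank ℝ (Submodule.span ℝ (Set.range v)) := by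
  classical
  have := Fintype.ofFinite α
  have h : Submodule.span ℝ (Set.range v) = Submodule.span ℝ (Set.range fun s : S => v s) := by
    refine le_antisymm (Submodule.span_le.2 ?_) (Submodule.span_mono ?_)
    · rintro _ ⟨a, rfl⟩
      have := hS.2 a
      rwa [Set.image_eq_range] at this
    · rintro _ ⟨a, rfl⟩; exact ⟨a, rfl⟩
  rw [h, finrank_span_eq_card hS.1, ← Nat.card_coe_set_eq, Nat.card_eq_fintype_card]

open scoped Classical in
/-- The indicator vector of the complement of `S`. -/
noncomputable def complIndicator (S : Set α) : α → ℤ := fun a => if a ∈ S then 0 else 1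

/-- Passing to complements turns removal of `i` from a point into insertion of `i` into a base,
which is the form of `IsVectorBase.exchange`. -/
theorem hasExchange_bases [DecidableEq α] (v : α → M) :
    HasExchange (complIndicator '' {S | IsVectorBase v S}) := by
  rintro _ ⟨S, hS, rfl⟩ _ ⟨S', hS', rfl⟩ i hi
  have h : i ∈ S' ∧ i ∉ S := by
    simp only [complIndicator] at hi
    split_ifs at hi <;> simp_all
  obtain ⟨j, hj, hj', hbase⟩ := hS.exchange hS'.1 h.1 h.2
  refine ⟨j, by simp [complIndicator, hj, hj'], _, hbase, ?_⟩
  have hij : i ≠ j := by rintro rfl; exact h.2 hj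
  ext a
  by_cases h1 : a = i
  · subst h1; simp [complIndicator, h.2, hij]
  · by_cases h2 : a = j
    · subst h2; simp [complIndicator, h1, hj]
    · by_cases h3 : a ∈ S <;> simp [complIndicator, h1, h2, h3]

theorem sum_complIndicator [Fintype α] (S : Set α) :
    ∑ a, complIndicator S a = Fintype.card α - S.ncard := by
  classical
  have h : (Finset.univ.filter fun a => a ∉ S).card + (Finset.univ.filter fun a => a ∈ S).card =
      Fintype.card α := by
    rw [add_comm]; exact Finset.card_filter_add_card_filter_not _
  have h2 : S.ncard = (Finset.univ.filter fun a => a ∈ S).card := by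
    rw [← Set.ncard_coe_finset]; simp
  have h3 : ∑ a, complIndicator S a = (Finset.univ.filter fun a => a ∉ S).card := by
    simp [complIndicator, Finset.card_filter]
  rw [h3, h2, ← h]; push_cast; ring

end VectorConfiguration

/-! ### Incidence vectors, spanning trees and two-forests -/

namespace FeynmanDiagram

section Incidence

variable {V E W : Type*} [AddCommGroup W] [Module ℝ W] (G : FeynmanDiagram V E W)

open scoped Classical in
/-- The difference of the unit vectors at two vertices. -/
noncomputable def rootVec (u w : V) : V → ℝ := Pi.single u 1 - Pi.single w 1

/-- The incidence vector of an edge, with an arbitrary orientation. -/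
noncomputable def edgeVec (e : E) : V → ℝ :=
  rootVec (Quot.out (G.ends e)).1 (Quot.out (G.ends e)).2

theorem rootVec_swap (u w : V) : rootVec u w = -rootVec w u := by simp [rootVec]

theorem ends_eq_out (e : E) :
    G.ends e = s((Quot.out (G.ends e)).1, (Quot.out (G.ends e)).2) :=
  (Quot.out_eq (G.ends e)).symm

theorem edgeVec_eq_or {e : E} {u w : V} (h : G.ends e = s(u, w)) :
    G.edgeVec e = rootVec u w ∨ G.edgeVec e = -rootVec u w := by
  rw [G.ends_eq_out e, Sym2.eq_iff] at h
  rcases h with ⟨h1, h2⟩ | ⟨h1, h2⟩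
  · left; rw [edgeVec, h1, h2]
  · right; rw [edgeVec, h1, h2, rootVec_swap]

/-- The span of the incidence vectors of the edges in `S`. -/
noncomputable def edgeSpan (S : Set E) : Submodule ℝ (V → ℝ) :=
  Submodule.span ℝ (G.edgeVec '' S)

theorem edgeVec_mem_iff {e : E} {u w : V} (h : G.ends e = s(u, w)) (N : Submodule ℝ (V → ℝ)) :
    G.edgeVec e ∈ N ↔ rootVec u w ∈ N := by
  rcases G.edgeVec_eq_or h with h | h <;> simp [h]

theorem rootVec_mem_of_reachable {S : Set E} {u w : V} (h : (G.sub S).Reachable u w) :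
    rootVec u w ∈ G.edgeSpan S := by
  obtain ⟨p⟩ := h
  induction p with
  | nil => simp [rootVec]
  | @cons a b c hab p ih =>
    obtain ⟨_, e, he, hends⟩ := hab
    have h1 : rootVec a b ∈ G.edgeSpan S :=
      (G.edgeVec_mem_iff hends _).1 (Submodule.subset_span ⟨e, he, rfl⟩)
    have : rootVec a c = rootVec a b + rootVec b c := by simp [rootVec]
    rw [this]
    exact add_mem h1 ih

variable [Fintype V]

open scoped Classical in
/-- The sum of the values at the vertices of the component of `a`. -/
noncomputable def compSum (S : Set E) (a : V) : (V → ℝ) →ₗ[ℝ] ℝ :=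
  sumOver (Finset.univ.filter fun w => (G.sub S).Reachable a w)

open scoped Classical in
theorem compSum_apply (S : Set E) (a : V) (x : V → ℝ) :
    G.compSum S a x = ∑ w, if (G.sub S).Reachable a w then x w else 0 := by
  rw [compSum, sumOver_apply, Finset.sum_filter]

open scoped Classical in
theorem compSum_rootVec (S : Set E) (a u w : V) :
    G.compSum S a (rootVec u w) = (if (G.sub S).Reachable a u then 1 else 0) -
      (if (G.sub S).Reachable a w then 1 else 0) := by
  simp [rootVec, compSum, sumOver_apply, Pi.single_apply]

omit [Fintype V] in
theorem reachable_of_mem_ends {S : Set E} {e : E} (he : e ∈ S) {u w : V}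
    (h : G.ends e = s(u, w)) : (G.sub S).Reachable u w := by
  by_cases huw : u = w
  · rw [huw]
  · exact SimpleGraph.Adj.reachable ⟨huw, e, he, h⟩

theorem compSum_eq_zero {S : Set E} (a : V) {x : V → ℝ} (hx : x ∈ G.edgeSpan S) :
    G.compSum S a x = 0 := by
  suffices h : G.edgeSpan S ≤ LinearMap.ker (G.compSum S a) from h hx
  refine Submodule.span_le.2 ?_
  rintro _ ⟨e, he, rfl⟩
  have h := G.reachable_of_mem_ends he (G.ends_eq_out e)
  rw [SetLike.mem_coe, LinearMap.mem_ker, edgeVec, compSum_rootVec, sub_eq_zero]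
  congr 1
  exact propext ⟨fun h' => h'.trans h, fun h' => h'.trans h.symm⟩

/-- The sum over the component of `u` kills all edge vectors of `S`, but is `1` on `rootVec u w`
when `w` lies outside that component. -/
theorem reachable_iff_rootVec_mem {S : Set E} {u w : V} :
    (G.sub S).Reachable u w ↔ rootVec u w ∈ G.edgeSpan S := by
  refine ⟨G.rootVec_mem_of_reachable, fun h => ?_⟩
  by_contra hr
  have := G.compSum_eq_zero u h
  simp [compSum_rootVec, hr] at this

theorem isForest_iff {S : Set E} : G.IsForest S ↔ LinearIndepOn ℝ G.edgeVec S := by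
  rw [linearIndepOn_iff_notMem_span]
  refine forall₂_congr fun e he => ⟨fun h => ?_, fun h u w huw => ?_⟩
  · have := h _ _ (G.ends_eq_out e)
    rw [reachable_iff_rootVec_mem] at this
    exact this
  · rw [reachable_iff_rootVec_mem, ← G.edgeVec_mem_iff huw]
    exact h

theorem sum_rootVec (u w : V) : ∑ i, rootVec u w i = 0 := by
  simp [rootVec, Finset.sum_sub_distrib]

theorem mem_edgeSpan_of_connected {S : Set E} (h : (G.sub S).Connected) {x : V → ℝ}
    (hx : ∑ i, x i = 0) : x ∈ G.edgeSpan S := by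
  classical
  obtain ⟨a⟩ := h.nonempty
  have : x = ∑ i, x i • rootVec i a := by
    ext k
    simp [rootVec, Pi.single_apply, mul_sub, Finset.sum_sub_distrib, hx]
  rw [this]
  exact sum_mem fun i _ => Submodule.smul_mem _ _ (G.rootVec_mem_of_reachable (h.preconnected i a))

omit [Fintype V] in
theorem exists_not_reachable {S : Set E} (h : Nat.card (G.sub S).ConnectedComponent = 2) (a : V) :
    ∃ b, ¬ (G.sub S).Reachable a b ∧ ∀ w, ¬ (G.sub S).Reachable a w → (G.sub S).Reachable b w := by
  obtain ⟨c, hc, huniq⟩ := (Nat.card_eq_two_iff' ((G.sub S).connectedComponentMk a)).1 h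
  induction c using SimpleGraph.ConnectedComponent.ind with
  | _ b =>
    refine ⟨b, fun h => hc (SimpleGraph.ConnectedComponent.eq.2 h.symm), fun w hw => ?_⟩
    have := huniq ((G.sub S).connectedComponentMk w) fun h =>
      hw (SimpleGraph.ConnectedComponent.eq.1 h).symm
    exact (SimpleGraph.ConnectedComponent.eq.1 this).symm

/-- If there are two components, `edgeSpan` has codimension one in the vectors with sum zero. -/
theorem sub_compSum_smul_mem {S : Set E} {a b : V}
    (h : ∀ w, ¬ (G.sub S).Reachable a w → (G.sub S).Reachable b w) {x : V → ℝ}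
    (hx : ∑ i, x i = 0) : x - G.compSum S a x • rootVec a b ∈ G.edgeSpan S := by
  classical
  have : x - G.compSum S a x • rootVec a b =
      ∑ i, x i • rootVec i (if (G.sub S).Reachable a i then a else b) := by
    have h1 : ∀ i, x i • rootVec i (if (G.sub S).Reachable a i then a else b) =
        x i • rootVec i b - (if (G.sub S).Reachable a i then x i else 0) • rootVec a b := by
      intro i
      split_ifs
      · simp only [rootVec]; module
      · simp
    simp_rw [h1]
    rw [Finset.sum_sub_distrib, ← Finset.sum_smul, ← compSum_apply]
    congr 1
    ext k
    simp [rootVec, Pi.single_apply, mul_sub, Finset.sum_sub_distrib, hx]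
  rw [this]
  refine sum_mem fun i _ => Submodule.smul_mem _ _ (G.rootVec_mem_of_reachable ?_)
  split_ifs with hi
  · exact hi.symm
  · exact (h i hi).symm

theorem mem_edgeSpan_iff {S : Set E} (h : Nat.card (G.sub S).ConnectedComponent = 2) (a : V)
    {x : V → ℝ} (hx : ∑ i, x i = 0) : x ∈ G.edgeSpan S ↔ G.compSum S a x = 0 := by
  refine ⟨G.compSum_eq_zero a, fun h0 => ?_⟩
  obtain ⟨b, -, hb⟩ := G.exists_not_reachable h a
  simpa [h0] using G.sub_compSum_smul_mem hb hx

/-- Modulo the edge span, `x` and `y` are multiples of the same `rootVec a b`, and the multiple for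
`x` is nonzero. -/
theorem mem_span_insert {S : Set E} (h : Nat.card (G.sub S).ConnectedComponent = 2) {a : V}
    {x y : V → ℝ} (hx : ∑ i, x i = 0) (hxa : G.compSum S a x ≠ 0) (hy : ∑ i, y i = 0) :
    y ∈ Submodule.span ℝ (insert x (G.edgeVec '' S)) := by
  obtain ⟨b, -, hb⟩ := G.exists_not_reachable h a
  have h1 := G.sub_compSum_smul_mem hb hx
  have h2 := G.sub_compSum_smul_mem hb hy
  refine Submodule.mem_span_insert.2 ⟨G.compSum S a y / G.compSum S a x, _,
    sub_mem h2 (Submodule.smul_mem _ (G.compSum S a y / G.compSum S a x) h1), ?_⟩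
  rw [smul_sub, smul_smul, div_mul_cancel₀ _ hxa]
  abel

theorem sum_edgeVec (e : E) : ∑ i, G.edgeVec e i = 0 := sum_rootVec _ _

theorem connected_of_edgeVec_mem [Nonempty V] (hG : (G.sub Set.univ).Connected) {S : Set E}
    (h : ∀ e, G.edgeVec e ∈ G.edgeSpan S) : (G.sub S).Connected := by
  refine ⟨fun u w => G.reachable_iff_rootVec_mem.2 ?_⟩
  refine Submodule.span_le.2 ?_ (G.rootVec_mem_of_reachable (hG.preconnected u w))
  rintro _ ⟨e, -, rfl⟩
  exact h e

/-- A spanning two-forest is contained in a spanning tree with one more edge. -/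
theorem IsSpanningTwoForest.exists_insert [Nonempty V] {G : FeynmanDiagram V E W}
    (hG : (G.sub Set.univ).Connected) {F : Set E} (hF : G.IsSpanningTwoForest F) :
    ∃ e ∉ F, G.IsSpanningTree (insert e F) := by
  obtain ⟨a⟩ := ‹Nonempty V›
  have : Nonempty V := ⟨a⟩
  obtain ⟨b, hab, -⟩ := G.exists_not_reachable hF.2 a
  obtain ⟨e, he⟩ : ∃ e, G.edgeVec e ∉ G.edgeSpan F := by
    by_contra! h
    exact hab ((G.connected_of_edgeVec_mem hG h).preconnected a b)
  refine ⟨e, fun h => he (Submodule.subset_span ⟨e, h, rfl⟩), ?_, ?_⟩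
  · rw [isForest_iff]
    exact (G.isForest_iff.1 hF.1).insert he
  · refine G.connected_of_edgeVec_mem hG fun e' => ?_
    rw [edgeSpan, Set.image_insert_eq]
    refine G.mem_span_insert hF.2 (a := a) (G.sum_edgeVec e) ?_ (G.sum_edgeVec e')
    rwa [ne_eq, ← G.mem_edgeSpan_iff hF.2 a (G.sum_edgeVec e)]

/-- The incidence vectors of the edges, together with one more vector `p`. -/
noncomputable def extVec (p : V → ℝ) : Option E → V → ℝ := fun o => o.elim p G.edgeVec

omit [Fintype V] in
theorem linearIndepOn_extVec {p : V → ℝ} {T : Set E} :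
    LinearIndepOn ℝ (G.extVec p) (some '' T) ↔ LinearIndepOn ℝ G.edgeVec T := by
  simp_rw [linearIndepOn_iff_notMem_span, Set.forall_mem_image]
  refine forall₂_congr fun e _ => ?_
  rw [← Set.image_singleton, ← Set.image_sdiff (Option.some_injective E), Set.image_image]
  rfl

/-- A vector of total zero lies in the span of any connected edge set, so `p` imposes no extra
condition. -/
theorem isVectorBase_image_some [Nonempty V] (hG : (G.sub Set.univ).Connected) {p : V → ℝ}
    (hp : ∑ v, p v = 0) {T : Set E} :
    IsVectorBase (G.extVec p) (some '' T) ↔ G.IsSpanningTree T := by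
  have h1 : G.extVec p '' (some '' T) = G.edgeVec '' T := by
    rw [Set.image_image]; rfl
  rw [IsVectorBase, h1, linearIndepOn_extVec, ← isForest_iff, IsSpanningTree]
  refine and_congr_right fun _ => ⟨fun h => ?_, fun h => ?_⟩
  · exact G.connected_of_edgeVec_mem hG fun e => h (some e)
  · rintro (_ | e)
    · exact G.mem_edgeSpan_of_connected h hp
    · exact G.mem_edgeSpan_of_connected h (G.sum_edgeVec e)

theorem isVectorBase_insert_none [Nonempty V] (hG : (G.sub Set.univ).Connected) {p : V → ℝ}
    (hp : ∑ v, p v = 0) {F : Set E} (a : V) :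
    IsVectorBase (G.extVec p) (insert none (some '' F)) ↔
      G.IsSpanningTwoForest F ∧ G.compSum F a p ≠ 0 := by
  have h1 : G.extVec p '' (some '' F) = G.edgeVec '' F := by
    rw [Set.image_image]; rfl
  have h0 : (none : Option E) ∉ some '' F := by simp
  have hnone : G.extVec p none = p := rfl
  rw [IsVectorBase, linearIndepOn_insert h0, Set.image_insert_eq, h1, linearIndepOn_extVec,
    ← isForest_iff, hnone]
  constructor
  · rintro ⟨⟨hF, hpF⟩, hspan⟩
    have hspan' : ∀ u w : V, rootVec u w ∈ Submodule.span ℝ (insert p (G.edgeVec '' F)) := by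
      intro u w
      refine Submodule.span_le.2 ?_ (G.rootVec_mem_of_reachable (hG.preconnected u w))
      rintro _ ⟨e, -, rfl⟩
      exact hspan (some e)
    obtain ⟨u, w, huw⟩ : ∃ u w, ¬ (G.sub F).Reachable u w := by
      by_contra! h
      exact hpF (G.mem_edgeSpan_of_connected ⟨h⟩ hp)
    have hall : ∀ t, (G.sub F).Reachable u t ∨ (G.sub F).Reachable w t := by
      intro t
      by_contra! ht
      -- With three components the single vector `p` would have to supply two missing dimensions;
      -- component sums at `u` and `w` expose the contradiction.
      obtain ⟨c, s, hs, h3⟩ := Submodule.mem_span_insert.1 (hspan' u t)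
      obtain ⟨c', s', hs', h4⟩ := Submodule.mem_span_insert.1 (hspan' w t)
      have hwu : ¬ (G.sub F).Reachable w u := fun h => huw h.symm
      have h5 := congrArg (G.compSum F u) h3
      have h6 := congrArg (G.compSum F u) h4
      have h7 := congrArg (G.compSum F w) h4
      rw [map_add, G.compSum_eq_zero _ hs, compSum_rootVec, map_smul] at h5
      rw [map_add, G.compSum_eq_zero _ hs', compSum_rootVec, map_smul] at h6 h7
      simp [ht.1, ht.2, huw] at h5 h6 h7
      rcases h6 with h6 | h6
      · simp [h6] at h7
      · simp [h6] at h5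
    have hcard : Nat.card (G.sub F).ConnectedComponent = 2 := by
      rw [Nat.card_eq_two_iff]
      refine ⟨(G.sub F).connectedComponentMk u, (G.sub F).connectedComponentMk w,
        fun h => huw (SimpleGraph.ConnectedComponent.eq.1 h), ?_⟩
      ext c
      induction c using SimpleGraph.ConnectedComponent.ind with
      | _ t =>
        simp only [Set.mem_insert_iff, Set.mem_singleton_iff, Set.mem_univ, iff_true,
          SimpleGraph.ConnectedComponent.eq]
        exact (hall t).imp SimpleGraph.Reachable.symm SimpleGraph.Reachable.symm
    exact ⟨⟨hF, hcard⟩, fun h => hpF ((G.mem_edgeSpan_iff hcard a hp).2 h)⟩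
  · rintro ⟨hF, hpa⟩
    refine ⟨⟨hF.1, fun h => hpa ((G.mem_edgeSpan_iff hF.2 a hp).1 h)⟩, ?_⟩
    rintro (_ | e)
    · exact G.mem_span_insert hF.2 hp hpa hp
    · exact G.mem_span_insert hF.2 hp hpa (G.sum_edgeVec e)

theorem span_range_extVec (hG : (G.sub Set.univ).Connected) {p : V → ℝ} (hp : ∑ v, p v = 0) :
    Submodule.span ℝ (Set.range (G.extVec p)) = LinearMap.ker (sumOver (Finset.univ : Finset V)) := by
  refine le_antisymm (Submodule.span_le.2 ?_) fun x hx => ?_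
  · rintro _ ⟨_ | e, rfl⟩
    · exact (sumOver_apply _ _).trans hp
    · exact (sumOver_apply _ _).trans (G.sum_edgeVec e)
  · rw [LinearMap.mem_ker, sumOver_apply] at hx
    refine Submodule.span_mono ?_ (G.mem_edgeSpan_of_connected hG hx)
    rintro _ ⟨e, -, rfl⟩
    exact ⟨some e, rfl⟩

theorem finrank_ker_sumOver [Nonempty V] :
    Module.finrank ℝ (LinearMap.ker (sumOver (Finset.univ : Finset V))) + 1 = Fintype.card V := by
  classical
  have h := LinearMap.finrank_range_add_finrank_ker (sumOver (Finset.univ : Finset V))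
  have hsurj : Function.Surjective (sumOver (Finset.univ : Finset V)) := by
    intro t
    obtain ⟨a⟩ := ‹Nonempty V›
    exact ⟨Pi.single a t, by simp [sumOver_apply]⟩
  rw [LinearMap.range_eq_top.2 hsurj, finrank_top, Module.finrank_self, Module.finrank_pi] at h
  omega

/-- The number of elements in a base of the extended incidence vectors. -/
theorem ncard_base [Finite E] [Nonempty V] (hG : (G.sub Set.univ).Connected) {p : V → ℝ}
    (hp : ∑ v, p v = 0) {S : Set (Option E)} (hS : IsVectorBase (G.extVec p) S) :
    S.ncard + 1 = Fintype.card V := by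
  rw [hS.ncard, G.span_range_extVec hG hp, finrank_ker_sumOver]

end Incidence

end FeynmanDiagram

/-! ### Replacing vector momenta by scalar momenta -/

namespace FeynmanDiagram

section Momenta

variable {V E W : Type*} [AddCommGroup W] [Module ℝ W] (G : FeynmanDiagram V E W) [Fintype V]

open scoped Classical in
/-- For a linear functional `φ`, the scalar momenta `φ(p_v)` have `φ(p(F))` as component sums. -/
theorem compSum_functional (φ : W →ₗ[ℝ] ℝ) (S : Set E) (a : V) :
    G.compSum S a (fun v => if v ∈ G.ext then φ (G.mom v) else 0) =
      φ (G.componentMomentum S a) := by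
  rw [compSum_apply, componentMomentum, map_sum, Finset.sum_filter]
  rw [← Finset.sum_subset (Finset.subset_univ G.ext)]
  · exact Finset.sum_congr rfl fun v hv => by simp [hv]
  · intro v _ hv
    simp [hv]

/-- There are scalar momenta with the same vanishing component sums as the given momenta. -/
theorem IsEuclidean.exists_scalar_momenta [Nonempty V] [Finite E] {G : FeynmanDiagram V E W}
    (hE : G.IsEuclidean) : ∃ p : V → ℝ, ∑ v, p v = 0 ∧
      ∀ S : Set E, G.IsSpanningTwoForest S →
        (G.momSq S ≠ 0 ↔ G.compSum S (Classical.arbitrary V) p ≠ 0) := by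
  classical
  set a := Classical.arbitrary V with ha
  rcases hE with hpos | hpos
  -- A generic functional is nonzero on each of the finitely many nonzero component momenta.
  · obtain ⟨φ, hφ⟩ := Module.exists_dual_forall_apply_ne_zero (K := ℝ)
      (fun S : {S : Set E // G.componentMomentum S a ≠ 0} => G.componentMomentum S.1 a)
      (fun S => S.2)
    refine ⟨fun v => if v ∈ G.ext then φ (G.mom v) else 0, ?_, fun S _ => ?_⟩
    · rw [Finset.sum_ite_mem, Finset.univ_inter, ← map_sum, G.conservation, map_zero]
    · have h := G.compSum_functional φ S a
      rw [show G.momSq S = G.form (G.componentMomentum S a) from rfl, ne_eq,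
        hpos.anisotropic.eq_zero_iff]
      constructor
      · intro h0
        convert hφ ⟨S, h0⟩ using 1
      · rintro h1 h0
        rw [h0, map_zero] at h
        apply h1
        convert h
  -- Here no two-forest may have zero component sum. This `p` has total zero, and its sum over the
  -- component of `a` is the size of that component minus `|V|`, hence negative.
  · refine ⟨1 - Pi.single a (Fintype.card V : ℝ), by simp, fun S hS => ?_⟩
    refine iff_of_true (hpos S hS).ne' ?_
    obtain ⟨b, hb, -⟩ := G.exists_not_reachable hS.2 a
    have hlt : (Finset.univ.filter fun w => (G.sub S).Reachable a w).card < Fintype.card V :=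
      Finset.card_lt_univ_of_notMem (x := b) (by simpa using hb)
    have : G.compSum S a (1 - Pi.single a (Fintype.card V : ℝ)) =
        (Finset.univ.filter fun w => (G.sub S).Reachable a w).card - (Fintype.card V : ℝ) := by
      rw [map_sub]
      simp [compSum, sumOver_apply, Pi.single_apply]
    rw [this]
    have : ((Finset.univ.filter fun w => (G.sub S).Reachable a w).card : ℝ) < Fintype.card V := by
      exact_mod_cast hlt
    exact (sub_neg.2 this).ne

omit [Fintype V] in
theorem IsEuclidean.momSq_nonneg [Nonempty V] {G : FeynmanDiagram V E W}
    (hE : G.IsEuclidean) {S : Set E} (hS : G.IsSpanningTwoForest S) : 0 ≤ G.momSq S := by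
  rcases hE with h | h
  · exact h.nonneg _
  · exact (h S hS).le

end Momenta

end FeynmanDiagram

/-! ### Supports of polynomials with nonnegative coefficients -/

section Support

variable {ι κ : Type*}

open MvPolynomial

theorem coeff_sum_monomial (s : Finset κ) (c : κ → ℝ) (a : κ → ι →₀ ℕ) (m : ι →₀ ℕ) :
    letI := Classical.decEq (ι →₀ ℕ)
    coeff m (∑ k ∈ s, monomial (a k) (c k)) = ∑ k ∈ s, if a k = m then c k else 0 := by
  classical
  rw [coeff_sum]
  exact Finset.sum_congr rfl fun k _ => by rw [coeff_monomial]; congr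

theorem coeff_sum_monomial_nonneg {s : Finset κ} {c : κ → ℝ} (hc : ∀ k ∈ s, 0 ≤ c k)
    (a : κ → ι →₀ ℕ) (m : ι →₀ ℕ) : 0 ≤ coeff m (∑ k ∈ s, monomial (a k) (c k)) := by
  rw [coeff_sum_monomial]
  exact Finset.sum_nonneg fun k hk => by split_ifs <;> simp [hc k hk]

/-- Different indices may share an exponent; nonnegativity rules out cancellation. -/
theorem support_sum_monomial {s : Finset κ} {c : κ → ℝ} (hc : ∀ k ∈ s, 0 ≤ c k)
    (a : κ → ι →₀ ℕ) :
    ((∑ k ∈ s, monomial (a k) (c k)).support : Set (ι →₀ ℕ)) = a '' {k | k ∈ s ∧ c k ≠ 0} := by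
  ext m
  rw [Finset.mem_coe, mem_support_iff, coeff_sum_monomial, ne_eq, Finset.sum_eq_zero_iff_of_nonneg
    (fun k hk => by split_ifs <;> simp [hc k hk])]
  push Not
  constructor
  · rintro ⟨k, hk, h⟩
    split_ifs at h with h1
    · exact ⟨k, ⟨hk, h⟩, h1⟩
    · exact absurd rfl h
  · rintro ⟨k, ⟨hk, h⟩, rfl⟩
    exact ⟨k, hk, by simpa using h⟩

theorem support_add_of_nonneg {f g : MvPolynomial ι ℝ} (hf : ∀ m, 0 ≤ coeff m f)
    (hg : ∀ m, 0 ≤ coeff m g) :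
    ((f + g).support : Set (ι →₀ ℕ)) = (f.support : Set (ι →₀ ℕ)) ∪ g.support := by
  ext m
  have h1 := hf m
  have h2 := hg m
  simp only [Finset.mem_coe, mem_support_iff, coeff_add, Set.mem_union, ne_eq]
  rw [add_eq_zero_iff_of_nonneg h1 h2]
  tauto

end Support

/-! ### Newton polytopes of the Symanzik polynomials -/

namespace FeynmanDiagram

section Polynomials

open MvPolynomial

variable {V E W : Type*} [AddCommGroup W] [Module ℝ W] (G : FeynmanDiagram V E W)

/-- The point `∑_{e ∉ S} e` of `ℝ^E`. -/
noncomputable def complPoint (S : Set E) : E → ℝ := fun e => (complIndicator S e : ℝ)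

variable [Fintype E]

open scoped Classical in
/-- The exponent vector of `complMonomial S`. -/
noncomputable def complExponent (S : Finset E) : E →₀ ℕ := ∑ e ∈ Sᶜ, Finsupp.single e 1

theorem complMonomial_eq (S : Finset E) : complMonomial S = monomial (complExponent S) (1 : ℝ) := by
  rw [complMonomial, complExponent, monomial_sum_one]
  rfl

theorem complExponent_apply (S : Finset E) (e : E) :
    (complExponent S e : ℝ) = complPoint (S : Set E) e := by
  classical
  simp [complExponent, complPoint, complIndicator, Finsupp.single_apply]

theorem complExponent_insert [DecidableEq E] {S : Finset E} {e : E} (he : e ∉ S) :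
    complExponent (insert e S) + Finsupp.single e 1 = complExponent S := by
  have h : Sᶜ = insert e (insert e S)ᶜ := by
    ext x; by_cases hx : x = e <;> simp [hx, he]
  unfold complExponent
  convert (Finset.sum_insert (s := (insert e S)ᶜ) (a := e)
    (f := fun e => Finsupp.single e (1 : ℕ)) (by simp)).symm using 1
  · rw [add_comm]; congr!
  · rw [← h]; congr!

open scoped Classical in
theorem polyU_eq : G.polyU =
    ∑ T ∈ Finset.univ.filter (fun T : Finset E => G.IsSpanningTree (T : Set E)),
      monomial (complExponent T) (1 : ℝ) := by
  simp_rw [polyU, complMonomial_eq]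

open scoped Classical in
theorem polyF₀_eq [Nonempty V] : G.polyF₀ =
    ∑ S ∈ Finset.univ.filter (fun S : Finset E => G.IsSpanningTwoForest (S : Set E)),
      monomial (complExponent S) (G.momSq (S : Set E)) := by
  simp_rw [polyF₀, complMonomial_eq, C_mul_monomial, mul_one]

open scoped Classical in
theorem polyU_mul_eq : G.polyU * (∑ e, C (G.mass e ^ 2) * X e) =
    ∑ k ∈ (Finset.univ.filter fun T : Finset E => G.IsSpanningTree (T : Set E)) ×ˢ Finset.univ,
      monomial (complExponent k.1 + Finsupp.single k.2 1) (G.mass k.2 ^ 2) := by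
  rw [polyU_eq, Finset.sum_mul_sum, Finset.sum_product]
  refine Finset.sum_congr rfl fun T _ => Finset.sum_congr rfl fun e _ => ?_
  rw [X, C_mul_monomial, monomial_mul, mul_one, one_mul]

/-- The points of the monomials of `𝒰`. -/
def treePoints : Set (E → ℝ) := complPoint '' {T | G.IsSpanningTree T}

/-- The points of the monomials of `ℱ₀`. -/
def twoForestPoints [Nonempty V] : Set (E → ℝ) :=
  complPoint '' {F | G.IsSpanningTwoForest F ∧ G.momSq F ≠ 0}

theorem image_complExponent (p : Set E → Prop) :
    (fun (a : E →₀ ℕ) (i : E) => (a i : ℝ)) '' (complExponent '' {T : Finset E | p T}) =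
      complPoint '' {T | p T} := by
  classical
  rw [Set.image_image]
  simp_rw [complExponent_apply]
  ext x
  constructor
  · rintro ⟨T, hT, rfl⟩
    exact ⟨T, hT, rfl⟩
  · rintro ⟨T, hT, rfl⟩
    exact ⟨T.toFinset, by simpa using hT, by simp⟩

theorem support_polyU : (G.polyU.support : Set (E →₀ ℕ)) =
    complExponent '' {T : Finset E | G.IsSpanningTree (T : Set E)} := by
  rw [polyU_eq, support_sum_monomial (fun _ _ => zero_le_one)]
  simp

theorem support_polyF₀ [Fintype V] [Nonempty V] (hE : G.IsEuclidean) :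
    (G.polyF₀.support : Set (E →₀ ℕ)) =
      complExponent '' {F : Finset E | G.IsSpanningTwoForest (F : Set E) ∧ G.momSq F ≠ 0} := by
  rw [polyF₀_eq, support_sum_monomial (fun S hS => hE.momSq_nonneg (by simpa using hS))]
  simp

theorem coeff_polyU_nonneg (m : E →₀ ℕ) : 0 ≤ coeff m G.polyU := by
  rw [polyU_eq]
  exact coeff_sum_monomial_nonneg (fun _ _ => zero_le_one) _ _

theorem coeff_polyF₀_nonneg [Fintype V] [Nonempty V] (hE : G.IsEuclidean) (m : E →₀ ℕ) :
    0 ≤ coeff m G.polyF₀ := by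
  rw [polyF₀_eq]
  exact coeff_sum_monomial_nonneg (fun S hS => hE.momSq_nonneg (by simpa using hS)) _ _

theorem newtonPolytope_polyU : newtonPolytope G.polyU = convexHull ℝ G.treePoints := by
  rw [newtonPolytope, support_polyU, image_complExponent, treePoints]

theorem newtonPolytope_polyF₀ [Fintype V] [Nonempty V] (hE : G.IsEuclidean) :
    newtonPolytope G.polyF₀ = convexHull ℝ G.twoForestPoints := by
  rw [newtonPolytope, support_polyF₀ G hE,
    image_complExponent (fun F => G.IsSpanningTwoForest F ∧ G.momSq F ≠ 0), twoForestPoints]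

theorem symanzikPolytope_massless [Fintype V] [Nonempty V] (hE : G.IsEuclidean)
    (hm : ∀ e, G.mass e = 0) :
    G.symanzikPolytope = convexHull ℝ (G.treePoints ∪ G.twoForestPoints) := by
  have hF : G.polyF = G.polyF₀ := by simp [polyF, hm]
  rw [symanzikPolytope, newtonPolytope, hF,
    support_add_of_nonneg G.coeff_polyU_nonneg (G.coeff_polyF₀_nonneg hE), support_polyU,
    support_polyF₀ G hE, Set.image_union, image_complExponent,
    image_complExponent (fun F => G.IsSpanningTwoForest F ∧ G.momSq F ≠ 0), treePoints,
    twoForestPoints]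

open scoped Classical in
/-- The vertices of `cornerSimplex E`. -/
def cornerPoints (E : Type*) : Set (E → ℝ) :=
  insert 0 (Set.range fun i : E => (Pi.single i (1 : ℝ) : E → ℝ))

theorem symanzikPolytope_massive [Fintype V] [Nonempty V] (hG : (G.sub Set.univ).Connected)
    (hE : G.IsEuclidean) (hm : ∀ e, G.mass e ≠ 0) :
    G.symanzikPolytope = convexHull ℝ (G.treePoints + cornerPoints E) := by
  classical
  have hmass : ∀ k ∈ (Finset.univ.filter fun T : Finset E => G.IsSpanningTree (T : Set E)) ×ˢ
      (Finset.univ : Finset E), 0 ≤ G.mass k.2 ^ 2 := fun _ _ => sq_nonneg _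
  have hUm : ∀ m, 0 ≤ coeff m (G.polyU * (∑ e, C (G.mass e ^ 2) * X e)) := fun m => by
    rw [polyU_mul_eq]; exact coeff_sum_monomial_nonneg hmass _ _
  have hFm : ∀ m, 0 ≤ coeff m G.polyF := fun m => by
    rw [polyF, coeff_add]; exact add_nonneg (hUm m) (G.coeff_polyF₀_nonneg hE m)
  have hsupp : ((G.polyU * (∑ e, C (G.mass e ^ 2) * X e)).support : Set (E →₀ ℕ)) =
      complExponent '' {T : Finset E | G.IsSpanningTree (T : Set E)} +
        Set.range fun e => Finsupp.single e 1 := by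
    rw [polyU_mul_eq, support_sum_monomial hmass]
    ext m
    simp only [Set.mem_image, Set.mem_add, Set.mem_range]
    constructor
    · rintro ⟨⟨T, e⟩, ⟨hT, -⟩, rfl⟩
      exact ⟨_, ⟨T, by simpa using hT, rfl⟩, _, ⟨e, rfl⟩, rfl⟩
    · rintro ⟨_, ⟨T, hT, rfl⟩, _, ⟨e, rfl⟩, rfl⟩
      exact ⟨(T, e), ⟨by simpa using hT, by simpa using hm e⟩, rfl⟩
  -- A two-forest is a spanning tree minus an edge `e`, so its monomial is that of the tree times
  -- `x_e`.
  have hsub : (G.polyF₀.support : Set (E →₀ ℕ)) ⊆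
      (G.polyU * (∑ e, C (G.mass e ^ 2) * X e)).support := by
    rw [support_polyF₀ G hE, hsupp]
    rintro _ ⟨F, ⟨hF, -⟩, rfl⟩
    obtain ⟨e, he, hT⟩ := hF.exists_insert hG
    refine ⟨_, ⟨insert e F, by simpa using hT, rfl⟩, _, ⟨e, rfl⟩, ?_⟩
    exact complExponent_insert (by simpa using he)
  rw [symanzikPolytope, newtonPolytope, support_add_of_nonneg G.coeff_polyU_nonneg hFm, polyF,
    support_add_of_nonneg hUm (G.coeff_polyF₀_nonneg hE), Set.union_eq_self_of_subset_right hsub,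
    hsupp, support_polyU]
  congr 1
  have hU := image_complExponent (E := E) (fun T => G.IsSpanningTree T)
  rw [treePoints, ← hU, cornerPoints]
  ext x
  constructor
  · rintro ⟨_, ⟨T, hT, rfl⟩ | ⟨_, ⟨T, hT, rfl⟩, _, ⟨e, rfl⟩, rfl⟩, rfl⟩
    · exact ⟨_, ⟨_, ⟨T, hT, rfl⟩, rfl⟩, 0, Or.inl rfl, by simp⟩
    · refine ⟨_, ⟨_, ⟨T, hT, rfl⟩, rfl⟩, Pi.single e 1, Or.inr ⟨e, rfl⟩, ?_⟩
      ext i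
      simp [Finsupp.single_apply, Pi.single_apply, eq_comm]
  · rintro ⟨_, ⟨_, ⟨T, hT, rfl⟩, rfl⟩, _, rfl | ⟨e, rfl⟩, rfl⟩
    · exact ⟨_, Or.inl ⟨T, hT, rfl⟩, by simp⟩
    · refine ⟨_, Or.inr ⟨_, ⟨T, hT, rfl⟩, Finsupp.single e 1, ⟨e, rfl⟩, rfl⟩, ?_⟩
      ext i
      simp [Finsupp.single_apply, Pi.single_apply, eq_comm]

end Polynomials

/-! ### Symanzik polytopes as projected base polytopes -/

section Main

variable {V E W : Type*} [AddCommGroup W] [Module ℝ W] (G : FeynmanDiagram V E W)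
  [Fintype V] [Nonempty V]

/-- The indicator vectors of the complements of the bases of the extended incidence vectors. -/
def baseSet (p : V → ℝ) : Set (Option E → ℤ) :=
  complIndicator '' {S | IsVectorBase (G.extVec p) S}

theorem forgetCoord_baseSet [Fintype E] (hG : (G.sub Set.univ).Connected) {p : V → ℝ}
    (hp : ∑ v, p v = 0) (a : V) :
    forgetCoord E '' realPoints (G.baseSet p) = G.treePoints ∪
      complPoint '' {F | G.IsSpanningTwoForest F ∧ G.compSum F a p ≠ 0} := by
  have h1 : ∀ T : Set E, forgetCoord E (fun o => (complIndicator (some '' T) o : ℝ)) =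
      complPoint T := fun T => by
    ext e; by_cases h : e ∈ T <;> simp [forgetCoord_apply, complPoint, complIndicator, h]
  have h2 : ∀ T : Set E, forgetCoord E (fun o => (complIndicator (insert none (some '' T)) o : ℝ)) =
      complPoint T := fun T => by
    ext e; by_cases h : e ∈ T <;> simp [forgetCoord_apply, complPoint, complIndicator, h]
  ext x
  constructor
  · rintro ⟨_, ⟨_, ⟨S, hS, rfl⟩, rfl⟩, rfl⟩
    by_cases hn : none ∈ S
    · obtain ⟨F, rfl⟩ : ∃ F : Set E, S = insert none (some '' F) :=
        ⟨some ⁻¹' S, by ext (_ | e) <;> simp [hn]⟩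
      exact Or.inr ⟨F, (G.isVectorBase_insert_none hG hp a).1 hS, (h2 F).symm⟩
    · obtain ⟨F, rfl⟩ : ∃ F : Set E, S = some '' F :=
        ⟨some ⁻¹' S, by ext (_ | e) <;> simp [hn]⟩
      exact Or.inl ⟨F, (G.isVectorBase_image_some hG hp).1 hS, (h1 F).symm⟩
  · rintro (⟨T, hT, rfl⟩ | ⟨F, hF, rfl⟩)
    · exact ⟨_, ⟨_, ⟨_, (G.isVectorBase_image_some hG hp).2 hT, rfl⟩, rfl⟩, h1 T⟩
    · exact ⟨_, ⟨_, ⟨_, (G.isVectorBase_insert_none hG hp a).2 hF, rfl⟩, rfl⟩, h2 F⟩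

/-- A base uses `|V| - 1` of the `|E| + 1` vectors, which leaves `L + 1` outside. -/
theorem sum_baseSet [Fintype E] (hG : (G.sub Set.univ).Connected) {p : V → ℝ}
    (hp : ∑ v, p v = 0) : ∀ b ∈ G.baseSet p, ∑ o, b o = G.loopNumber + 1 := by
  rintro _ ⟨S, hS, rfl⟩
  have := G.ncard_base hG hp hS
  rw [sum_complIndicator, Fintype.card_option, loopNumber]
  push_cast
  omega

theorem realPoints_range_single [Fintype E] [DecidableEq (Option E)] :
    forgetCoord E '' realPoints (Set.range fun o : Option E => (Pi.single o 1 : Option E → ℤ)) =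
      cornerPoints E := by
  classical
  rw [realPoints, ← Set.range_comp, ← Set.range_comp, cornerPoints]
  ext x
  constructor
  · rintro ⟨_ | e, rfl⟩
    · left; ext i; simp [forgetCoord_apply, Pi.single_apply]
    · right; exact ⟨e, by ext i; simp [forgetCoord_apply, Pi.single_apply]⟩
  · rintro (rfl | ⟨e, rfl⟩)
    · exact ⟨none, by ext i; simp [forgetCoord_apply, Pi.single_apply]⟩
    · exact ⟨some e, by ext i; simp [forgetCoord_apply, Pi.single_apply]⟩

/-- With all masses nonzero the Symanzik polytope is a projected sum of base polytopes. -/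
theorem symanzikPolytope_eq_massive [Fintype E] [DecidableEq (Option E)]
    (hG : (G.sub Set.univ).Connected) (hE : G.IsEuclidean) (hm : ∀ e, G.mass e ≠ 0) :
    G.symanzikPolytope = forgetCoord E '' convexHull ℝ (realPoints (G.baseSet 0 +
      Set.range fun o : Option E => (Pi.single o 1 : Option E → ℤ))) := by
  rw [G.symanzikPolytope_massive hG hE hm, LinearMap.image_convexHull, realPoints_add,
    Set.image_add, realPoints_range_single,
    -- For `p = 0` no component sum is nonzero, so only spanning trees remain.
    G.forgetCoord_baseSet hG (by simp) (Classical.arbitrary V)]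
  simp

theorem sum_baseSet_add [Fintype E] [DecidableEq (Option E)]
    (hG : (G.sub Set.univ).Connected) : ∀ b ∈ G.baseSet 0 +
      Set.range (fun o : Option E => (Pi.single o 1 : Option E → ℤ)),
      ∑ o, b o = G.loopNumber + 1 + 1 := by
  rintro _ ⟨b, hb, _, ⟨o, rfl⟩, rfl⟩
  simp [-Fintype.sum_option, Finset.sum_add_distrib, G.sum_baseSet hG (p := 0) (by simp) b hb]

/-- With all masses zero the Symanzik polytope is a projected base polytope. -/
theorem exists_symanzikPolytope_eq_massless [Fintype E]
    (hG : (G.sub Set.univ).Connected) (hE : G.IsEuclidean) (hm : ∀ e, G.mass e = 0) :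
    ∃ p : V → ℝ, ∑ v, p v = 0 ∧
      G.symanzikPolytope = forgetCoord E '' convexHull ℝ (realPoints (G.baseSet p)) := by
  obtain ⟨p, hp, h⟩ := hE.exists_scalar_momenta
  refine ⟨p, hp, ?_⟩
  rw [G.symanzikPolytope_massless hE hm, LinearMap.image_convexHull,
    G.forgetCoord_baseSet hG hp (Classical.arbitrary V), twoForestPoints]
  congr! 5 with F
  exact and_congr_right (h F)

theorem sum_complPoint [Fintype E] (S : Set E) :
    ∑ e, complPoint S e = Fintype.card E - S.ncard := by
  simp only [complPoint]
  exact_mod_cast sum_complIndicator S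

theorem sum_treePoints [Fintype E] (hG : (G.sub Set.univ).Connected) :
    ∀ x ∈ G.treePoints, ∑ e, x e = G.loopNumber := by
  rintro _ ⟨T, hT, rfl⟩
  have h := G.ncard_base hG (p := 0) (by simp) ((G.isVectorBase_image_some hG (by simp)).2 hT)
  rw [Set.ncard_image_of_injective _ (Option.some_injective E)] at h
  rw [sum_complPoint, loopNumber, ← h]
  push_cast
  ring

theorem sum_twoForestPoints [Fintype E] (hG : (G.sub Set.univ).Connected) :
    ∀ x ∈ G.twoForestPoints, ∑ e, x e = G.loopNumber + 1 := by
  rintro _ ⟨F, ⟨hF, hF'⟩, rfl⟩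
  obtain ⟨e, he, hT⟩ := hF.exists_insert hG
  have h := G.sum_treePoints hG _ ⟨_, hT, rfl⟩
  rw [sum_complPoint, Set.ncard_insert_of_notMem he] at h
  rw [sum_complPoint, ← h]
  push_cast
  ring

/-- The height `∑ y_e - L` is `0` on tree points and `1` on two-forest points, and affine maps
commute with convex hulls. -/
theorem image_symanzikPolytope_eq_cayleySum [Fintype E]
    (hG : (G.sub Set.univ).Connected) (hE : G.IsEuclidean) (hm : ∀ e, G.mass e = 0) :
    (fun y : E → ℝ => appendCoord y (∑ e, y e - (G.loopNumber : ℝ))) '' G.symanzikPolytope =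
      cayleySum (newtonPolytope G.polyU) (newtonPolytope G.polyF₀) := by
  have hfun : (fun y : E → ℝ => appendCoord y (∑ e, y e - (G.loopNumber : ℝ))) =
      appendAffine (sumOver Finset.univ) (-(G.loopNumber : ℝ)) := by
    ext1 y
    rw [appendAffine_apply, sumOver_apply, sub_eq_add_neg]
  have hconst : ∀ t : ℝ, (fun y : E → ℝ => appendCoord y t) = appendAffine 0 t := fun t => by
    ext1 y
    rw [appendAffine_apply, LinearMap.zero_apply, zero_add]
  rw [cayleySum, G.newtonPolytope_polyU, G.newtonPolytope_polyF₀ hE,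
    G.symanzikPolytope_massless hE hm, hfun, AffineMap.image_convexHull, Set.image_union,
    ← hfun, hconst 0, hconst 1, AffineMap.image_convexHull, AffineMap.image_convexHull,
    convexHull_convexHull_union_left, convexHull_convexHull_union_right, ← hconst, ← hconst]
  congr 2
  · exact Set.image_congr fun x hx => by rw [G.sum_treePoints hG x hx, sub_self]
  · exact Set.image_congr fun x hx => by
      rw [G.sum_twoForestPoints hG x hx, add_sub_cancel_left]

end Main

end FeynmanDiagram

theorem theorem1 {V E W : Type*} [Fintype V] [Nonempty V] [Fintype E]
    [AddCommGroup W] [Module ℝ W] (G : FeynmanDiagram V E W)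
    (hG : G.IsOnePI) (hE : G.IsEuclidean) :
    ((∀ e, G.mass e ≠ 0) →
      G.symanzikPolytope = newtonPolytope G.polyU + cornerSimplex E ∧
      IsEdgeUnimodular G.symanzikPolytope ∧
      IsIDP G.symanzikPolytope) ∧
    ((∀ e, G.mass e = 0) → G.ext = Finset.univ → (∀ v, G.form (G.mom v) ≠ 0) →
      (fun y : E → ℝ => appendCoord y (∑ e, y e - (G.loopNumber : ℝ))) '' G.symanzikPolytope =
        cayleySum (newtonPolytope G.polyU) (newtonPolytope G.polyF₀) ∧
      IsIDP (cayleySum (newtonPolytope G.polyU) (newtonPolytope G.polyF₀)) ∧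
      IsIDP G.symanzikPolytope) := by
  classical
  have hconn := hG.1
  constructor
  · intro hm
    have hexch : HasExchange (G.baseSet 0 +
        Set.range fun o : Option E => (Pi.single o 1 : Option E → ℤ)) :=
      (hasExchange_bases _).add hasExchange_range_single
    have hsum := G.sum_baseSet_add hconn
    refine ⟨?_, ?_, ?_⟩
    · rw [G.symanzikPolytope_massive hconn hE hm, convexHull_add, G.newtonPolytope_polyU]
      rfl
    · rw [G.symanzikPolytope_eq_massive hconn hE hm]
      exact hexch.isEdgeUnimodular hsum
    · rw [G.symanzikPolytope_eq_massive hconn hE hm]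
      exact (hexch.isIDP hsum).forgetCoord (convex_convexHull ℝ _)
        fun x hx => sum_eq_of_mem_convexHull hsum hx
  · intro hm _ _
    obtain ⟨p, hp, heq⟩ := G.exists_symanzikPolytope_eq_massless hconn hE hm
    have hsum := G.sum_baseSet hconn hp
    have hexch : HasExchange (G.baseSet p) := hasExchange_bases _
    have hidp : IsIDP G.symanzikPolytope := by
      rw [heq]
      exact (hexch.isIDP hsum).forgetCoord (convex_convexHull ℝ _)
        fun x hx => sum_eq_of_mem_convexHull hsum hx
    have hcayley := G.image_symanzikPolytope_eq_cayleySum hconn hE hm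
    refine ⟨hcayley, ?_, hidp⟩
    rw [← hcayley]
    exact hidp.appendCoord (convex_convexHull ℝ _) _
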